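/- Let $K$ be a field of characteristic zero, let $S=K[x_1,x_2,x_3,x_4]$ with its standard grading, and let $I\subset S$ be a homogeneous ideal such that $A=S/I$ is an Artin Gorenstein algebra, i.e. $A$ is Artinian and its socle $0:_A(x_1,\dots,x_4)$ is one-dimensional over $K$. Suppose that $A$ has socle degree $5$ (the largest $j$ with $A_j\neq 0$ is $j=5$) and that $I$ is equigenerated, i.e. generated by forms of one common degree. Then the Hilbert function of $A$ is $H(A)=(1,4,10,10,4,1)$, i.e. $\dim_K A_j=1,4,10,10,4,1$ for $j=0,\dots,5$ and $A_j=0$ for all other $j$. Moreover, $A$ has a minimal graded free resolution over $S$, and in every minimal graded free resolution $\cdots\to F_1\to F_0\to A\to 0$ with $F_i\cong\bigoplus_{j}S(-j)^{b_{i,j}}$ finitely generated, the Betti numbers are given by the table $$ \begin{array}{c|ccccc} & 0 & 1 & 2 & 3 & 4\\ \hline 0 & 1 & \cdot & \cdot & \cdot & \cdot\\ 1 & \cdot & \cdot & \cdot & \cdot & \cdot\\ 2 & \cdot & 10 & 9 & \cdot & \cdot\\ 3 & \cdot & \cdot & 9 & 10 & \cdot\\ 4 & \cdot & \cdot & \cdot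 & \cdot & \cdot\\ 5 & \cdot & \cdot & \cdot & \cdot & 1 \end{array} $$ whose entry in column $i$ and row $j$ is $b_{i,i+j}$. That is, $b_{0,0}=1$, $b_{1,3}=10$, $b_{2,4}=b_{2,5}=9$, $b_{3,6}=10$, $b_{4,9}=1$, and all other $b_{i,j}$ are zero. -/

import Mathlib

namespace ArtinGor

noncomputable section

/-- The standard graded polynomial ring `S = K[x_1, …, x_n]`. -/
abbrev PolyRing (n : ℕ) (K : Type*) [Field K] : Type _ := MvPolynomial (Fin n) K

/-- The graded piece `S_j` for an integer `j` (every variable has degree `1`); it is zero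
for `j < 0`. -/
def polyPiece (n : ℕ) (K : Type*) [Field K] (j : ℤ) : Submodule K (PolyRing n K) :=
  MvPolynomial.weightedHomogeneousSubmodule K (fun _ : Fin n => (1 : ℤ)) j

/-- The homogeneous maximal ideal `(x_1, …, x_n)` of `S`. -/
def maxIdeal (n : ℕ) (K : Type*) [Field K] : Ideal (PolyRing n K) :=
  Ideal.span (Set.range MvPolynomial.X)

/-- The graded piece `A_j` of `A = S/I`, the image of `S_j`. -/
def quotPiece {n : ℕ} {K : Type*} [Field K] (I : Ideal (PolyRing n K)) (j : ℤ) :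
    Submodule K (PolyRing n K ⧸ I) :=
  (polyPiece n K j).map (Ideal.Quotient.mkₐ K I).toLinearMap

/-- The Hilbert function `H(A, j) = dim_K A_j` of `A = S/I`. -/
def hilbertFunction {n : ℕ} {K : Type*} [Field K] (I : Ideal (PolyRing n K)) (j : ℤ) : ℕ :=
  Module.finrank K (quotPiece I j)

/-- `H(A) = (h_0, …, h_s)`: these are the values of the Hilbert function in degrees
`0, …, s`, and it vanishes in all other degrees. -/
def HasHVector {n : ℕ} {K : Type*} [Field K] (I : Ideal (PolyRing n K)) {s : ℕ}
    (h : Fin (s + 1) → ℕ) : Prop :=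
  (∀ i : Fin (s + 1), hilbertFunction I ((i : ℕ) : ℤ) = h i) ∧
  ∀ j : ℤ, (j < 0 ∨ (s : ℤ) < j) → hilbertFunction I j = 0

/-- The socle `0 :_A (x_1, …, x_n)` of `A = S/I`, as a `K`-subspace. -/
def socle {n : ℕ} {K : Type*} [Field K] (I : Ideal (PolyRing n K)) :
    Submodule K (PolyRing n K ⧸ I) where
  carrier := {a | ∀ f ∈ maxIdeal n K, Ideal.Quotient.mk I f * a = 0}
  add_mem' := fun ha hb f hf => by rw [mul_add, ha f hf, hb f hf, add_zero]
  zero_mem' := fun f _ => mul_zero _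
  smul_mem' := fun c a ha f hf => by rw [mul_smul_comm, ha f hf, smul_zero]

/-- `A = S/I` is a (standard graded) Artin Gorenstein algebra: `I` is homogeneous
(it contains the homogeneous components of its elements), `A` is Artinian, and the socle of `A` is one-dimensional. -/
structure IsArtinGorenstein {n : ℕ} {K : Type*} [Field K] (I : Ideal (PolyRing n K)) :
    Prop where
  homogeneous : ∀ f ∈ I, ∀ k : ℕ, MvPolynomial.homogeneousComponent k f ∈ I
  artinian : IsArtinianRing (PolyRing n K ⧸ I)
  socle_dim : Module.finrank K (socle I) = 1

/-- The socle degree of `A = S/I` is `s`: the largest degree `j` with `A_j ≠ 0`. -/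
def HasSocleDegree {n : ℕ} {K : Type*} [Field K] (I : Ideal (PolyRing n K)) (s : ℤ) : Prop :=
  IsGreatest {j : ℤ | quotPiece I j ≠ ⊥} s

/-- `I` is equigenerated: it is generated by forms of one common degree. -/
def IsEquigenerated {n : ℕ} {K : Type*} [Field K] (I : Ideal (PolyRing n K)) : Prop :=
  ∃ (d : ℕ) (G : Set (PolyRing n K)), (∀ g ∈ G, g.IsHomogeneous d) ∧ Ideal.span G = I

/-- A minimal graded free resolution `⋯ → F_2 → F_1 → F_0 → S/I → 0` by finitely generated
graded free modules `F_i = ⨁_p S(-deg i p)`, all maps being homogeneous of degree `0`. Finite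
length is not required: it is a consequence in the cases of interest. -/
structure MinimalGradedFreeResolution {n : ℕ} {K : Type*} [Field K]
    (I : Ideal (PolyRing n K)) where
  /-- the rank of `F_i` -/
  rank : ℕ → ℕ
  /-- the degree of the `p`-th basis vector of `F_i` -/
  deg : (i : ℕ) → Fin (rank i) → ℤ
  /-- the differential `F_{i+1} → F_i` -/
  d : (i : ℕ) → (Fin (rank (i + 1)) → PolyRing n K) →ₗ[PolyRing n K]
    (Fin (rank i) → PolyRing n K)
  /-- the augmentation `F_0 → S/I` -/
  aug : (Fin (rank 0) → PolyRing n K) →ₗ[PolyRing n K] (PolyRing n K ⧸ I)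
  d_homogeneous : ∀ (i : ℕ) (q : Fin (rank (i + 1))) (p : Fin (rank i)),
    d i (Pi.single q 1) p ∈ polyPiece n K (deg (i + 1) q - deg i p)
  aug_homogeneous : ∀ p : Fin (rank 0), aug (Pi.single p 1) ∈ quotPiece I (deg 0 p)
  aug_surjective : Function.Surjective aug
  exact_zero : Function.Exact (d 0) aug
  exact_succ : ∀ i : ℕ, Function.Exact (d (i + 1)) (d i)
  /-- minimality: the image of `F_{i+1}` lies in `(x_1, …, x_n) F_i` -/
  minimal : ∀ (i : ℕ) (v : Fin (rank (i + 1)) → PolyRing n K) (p : Fin (rank i)),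
    d i v p ∈ maxIdeal n K

/-- The number `b_{i,j}` of summands `S(-j)` of `F_i`. -/
def MinimalGradedFreeResolution.betti {n : ℕ} {K : Type*} [Field K]
    {I : Ideal (PolyRing n K)} (F : MinimalGradedFreeResolution I) (i : ℕ) (j : ℤ) : ℕ :=
  Fintype.card {p : Fin (F.rank i) // F.deg i p = j}

/-- The Betti table of `S/I` is `T`: a minimal graded free resolution exists, and in every one
`b_{i,i+j}` is the entry of `T` in row `j` and column `i` (both counted from `0`), and is zero
outside `T`. -/
def HasBettiTable {n : ℕ} {K : Type*} [Field K] (I : Ideal (PolyRing n K)) {r c : ℕ}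
    (T : Matrix (Fin r) (Fin c) ℕ) : Prop :=
  Nonempty (MinimalGradedFreeResolution I) ∧
  ∀ F : MinimalGradedFreeResolution I,
    (∀ (j : Fin r) (i : Fin c), F.betti i (((i : ℕ) : ℤ) + ((j : ℕ) : ℤ)) = T j i) ∧
    ∀ (i : ℕ) (j : ℤ), (c ≤ i ∨ j < 0 ∨ (r : ℤ) ≤ j) → F.betti i ((i : ℤ) + j) = 0

end

end ArtinGor

/-!
Write `S = K[x₁, …, x₄]`, `m = (x₁, …, x₄)` and `A = S/I`.

*Hilbert function.* The socle of `A` is `A₅`, so the multiplication `A_j × A_{5-j} → A₅` is a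
perfect pairing and the Hilbert function is symmetric (`IsArtinGorenstein.hilbertFunction_symm`).
Let `d` be the common degree of the generators. If `d ≥ 4`, then `A₂ = S₂` and `A₃ = S₃` have
different dimensions, against the symmetry. If `d ≤ 2`, prime avoidance over the infinite field
`K` gives a regular sequence of four quadrics in `I`; the corresponding complete intersection has
Hilbert function `(1, 4, 6, 4, 1)`, whence `A₅ = 0`, which is absurd
(`mem_of_generated_degree_le_two`). So `d = 3`, `A` agrees with `S` up to degree `2`, and symmetry
gives `(1, 4, 10, 10, 4, 1)`.

*Total Betti numbers.* Let `F` be a minimal resolution. The Koszul complex on the variables is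
exact on free modules, so shifting dimensions along the syzygy modules identifies the rank of
`F_i` with `dim H_i(x; A)`, where `H_i(x; -)` is Koszul homology; in particular `F_i = 0` for `i ≥
5` (`MinimalGradedFreeResolution.rank_add_five`). Here `H₄(x; A)` is the socle, of dimension `1`,
and `H₁(x; A) = I/mI` has dimension `dim I₃ = 10`. As `A` is a Frobenius algebra, a matrix and its
transpose have the same `K`-rank on powers of `A` (`matRank_transpose`); since the Koszul complex
is its own transpose up to signs and order, `dim H₃(x; A) = dim H₁(x; A) = 10`. No grading is
needed in this part.

*Degrees.* The alternating sums `∑ (-1)^i b_{i,j}` are the coefficients of `(1 - t)^4 (1 + 4t +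
10t² + 10t³ + 4t⁴ + t⁵) = 1 - 10t³ + 9t⁴ + 9t⁵ - 10t⁶ + t⁹`. The twenty generators of `F₁` and
`F₃` are used up by the coefficients at `t³` and `t⁶`, so nothing cancels there, and the strict
growth of degrees along `F` separates the rest (`MinimalGradedFreeResolution.betti_eq`).

*Existence* of a minimal resolution is the recursive choice of a homogeneous generating system of
least cardinality for the successive kernels (`nonempty_minimalGradedFreeResolution`).
-/

namespace ArtinGor

open MvPolynomial

noncomputable section

/-! ### Homogeneous components of polynomials -/

section

variable {n : ℕ} {K : Type*} [Field K]

/-- The component of degree `j : ℤ` of a polynomial (zero for `j < 0`). -/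
def hcomp (j : ℤ) : PolyRing n K →ₗ[K] PolyRing n K :=
  weightedHomogeneousComponent (fun _ : Fin n => (1 : ℤ)) j

lemma weight_one_int (d : Fin n →₀ ℕ) :
    Finsupp.weight (fun _ : Fin n => (1 : ℤ)) d = (d.degree : ℤ) := by
  rw [Finsupp.weight_apply, Finsupp.degree_apply, Finsupp.sum]
  simp

lemma coeff_hcomp (j : ℤ) (f : PolyRing n K) (d : Fin n →₀ ℕ) :
    coeff d (hcomp j f) = if (d.degree : ℤ) = j then coeff d f else 0 := by
  classical
  rw [hcomp, coeff_weightedHomogeneousComponent, weight_one_int]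

lemma mem_polyPiece {j : ℤ} {f : PolyRing n K} :
    f ∈ polyPiece n K j ↔ ∀ d, coeff d f ≠ 0 → (d.degree : ℤ) = j := by
  rw [polyPiece, mem_weightedHomogeneousSubmodule, IsWeightedHomogeneous]
  simp only [weight_one_int]

lemma hcomp_mem (j : ℤ) (f : PolyRing n K) : hcomp j f ∈ polyPiece n K j :=
  weightedHomogeneousComponent_mem _ _ _

lemma hcomp_of_mem {j : ℤ} {f : PolyRing n K} (hf : f ∈ polyPiece n K j) : hcomp j f = f :=
  IsWeightedHomogeneous.weightedHomogeneousComponent_same hf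

lemma hcomp_of_mem_ne {i j : ℤ} {f : PolyRing n K} (hf : f ∈ polyPiece n K i) (h : i ≠ j) :
    hcomp j f = 0 :=
  IsWeightedHomogeneous.weightedHomogeneousComponent_ne _ hf h.symm

lemma polyPiece_neg {j : ℤ} (hj : j < 0) : polyPiece n K j = ⊥ := by
  rw [eq_bot_iff]
  intro f hf
  rw [Submodule.mem_bot]
  ext d
  by_contra h
  have := mem_polyPiece.1 hf d h
  omega

lemma mul_mem_polyPiece {i j : ℤ} {f g : PolyRing n K} (hf : f ∈ polyPiece n K i)
    (hg : g ∈ polyPiece n K j) : f * g ∈ polyPiece n K (i + j) :=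
  IsWeightedHomogeneous.mul hf hg

lemma X_mem_polyPiece (i : Fin n) : (X i : PolyRing n K) ∈ polyPiece n K 1 :=
  isWeightedHomogeneous_X K _ i

lemma isHomogeneous_iff_mem_polyPiece {d : ℕ} {f : PolyRing n K} :
    f.IsHomogeneous d ↔ f ∈ polyPiece n K d := by
  have h : ∀ e : Fin n →₀ ℕ, Finsupp.weight (1 : Fin n → ℕ) e = e.degree := fun e => by
    rw [Finsupp.degree_eq_weight_one]; rfl
  rw [mem_polyPiece, IsHomogeneous, IsWeightedHomogeneous]
  simp only [h, Nat.cast_inj]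

lemma sum_hcomp (f : PolyRing n K) :
    ∑ k ∈ Finset.range (f.totalDegree + 1), hcomp (k : ℤ) f = f := by
  ext d
  rw [coeff_sum]
  simp only [coeff_hcomp, Nat.cast_inj]
  rw [Finset.sum_ite_eq]
  split_ifs with h
  · rfl
  · by_contra h'
    have : d.degree ≤ f.totalDegree := by
      rw [Finsupp.degree_apply]
      exact le_totalDegree (mem_support_iff.2 (Ne.symm h'))
    simp at h
    omega

lemma hcomp_neg {j : ℤ} (hj : j < 0) (f : PolyRing n K) : hcomp j f = 0 := by
  have := hcomp_mem j f
  rwa [polyPiece_neg hj, Submodule.mem_bot] at this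

lemma hcomp_natCast (k : ℕ) (f : PolyRing n K) : hcomp (k : ℤ) f = homogeneousComponent k f := by
  ext d
  simp [coeff_hcomp, coeff_homogeneousComponent]

/-- Multiplication by a form of degree `e` shifts components by `e`. -/
lemma hcomp_mul_right {e : ℤ} (j : ℤ) (f : PolyRing n K) {g : PolyRing n K}
    (hg : g ∈ polyPiece n K e) : hcomp j (f * g) = hcomp (j - e) f * g := by
  conv_lhs => rw [← sum_hcomp f]
  rw [Finset.sum_mul, map_sum]
  have key : ∀ k : ℕ, hcomp j (hcomp (k : ℤ) f * g) = if (k : ℤ) = j - e then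
      hcomp (k : ℤ) f * g else 0 := by
    intro k
    have hm := mul_mem_polyPiece (hcomp_mem (k : ℤ) f) hg
    split_ifs with h
    · exact hcomp_of_mem (by rw [h, sub_add_cancel] at hm; rwa [h])
    · exact hcomp_of_mem_ne hm (by omega)
  simp only [key]
  rcases lt_or_ge (j - e) 0 with h | h
  · rw [hcomp_neg h, zero_mul]
    refine Finset.sum_eq_zero fun k _ => if_neg (by omega)
  · obtain ⟨m, hm⟩ := Int.eq_ofNat_of_zero_le h
    simp only [hm, Nat.cast_inj, Finset.sum_ite_eq']
    split_ifs with h'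
    · rfl
    · have : hcomp (m : ℤ) f = 0 := by
        rw [hcomp_natCast]
        refine homogeneousComponent_eq_zero _ _ ?_
        simp at h'
        omega
      rw [this, zero_mul]

lemma mem_maxIdeal {f : PolyRing n K} : f ∈ maxIdeal n K ↔ constantCoeff f = 0 := by
  have := mem_pow_idealOfVars_iff' (σ := Fin n) (R := K) 1 f
  rw [pow_one] at this
  refine this.trans ?_
  constructor
  · intro h
    exact h 0 (by simp)
  · intro h x hx
    have : x = 0 := by
      rw [Nat.lt_one_iff] at hx
      exact (Finsupp.degree_eq_zero_iff _).1 hx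
    subst this
    exact h

lemma pos_of_mem_maxIdeal {j : ℤ} {f : PolyRing n K} (hf : f ∈ polyPiece n K j)
    (hm : f ∈ maxIdeal n K) (h0 : f ≠ 0) : 0 < j := by
  obtain ⟨d, hd⟩ := MvPolynomial.ne_zero_iff.1 h0
  have h1 := mem_polyPiece.1 hf d hd
  rcases eq_or_ne d 0 with rfl | h
  · exact absurd (mem_maxIdeal.1 hm) hd
  · have : d.degree ≠ 0 := fun h' => h ((Finsupp.degree_eq_zero_iff _).1 h')
    omega

lemma mem_polyPiece_zero {f : PolyRing n K} (hf : f ∈ polyPiece n K 0) :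
    f = C (constantCoeff f) := by
  ext d
  rw [coeff_C]
  split_ifs with h
  · rw [← h]; rfl
  · by_contra h'
    have h1 := mem_polyPiece.1 hf d h'
    have h2 : d.degree = 0 := by exact_mod_cast h1
    exact h ((Finsupp.degree_eq_zero_iff _).1 h2).symm

lemma constantCoeff_hcomp_zero (f : PolyRing n K) :
    constantCoeff (hcomp 0 f) = constantCoeff f := by
  have := coeff_hcomp 0 f 0
  simpa [constantCoeff_eq] using this

instance finite_polyPiece (j : ℤ) : Module.Finite K (polyPiece n K j) := by
  rcases lt_or_ge j 0 with h | h
  · rw [polyPiece_neg h]; infer_instance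
  · obtain ⟨m, rfl⟩ := Int.eq_ofNat_of_zero_le h
    have : polyPiece n K (m : ℤ) = homogeneousSubmodule (Fin n) K m := by
      ext f
      rw [← isHomogeneous_iff_mem_polyPiece, mem_homogeneousSubmodule]
    rw [this]
    exact Module.Finite.iff_fg.2 (homogeneousSubmodule_fg _ _ _)

/-- There are `C(n + m - 1, m)` monomials of degree `m` in `n` variables. -/
lemma finrank_polyPiece_natCast (m : ℕ) :
    Module.finrank K (polyPiece n K (m : ℤ)) = n.multichoose m := by
  classical
  have h1 : polyPiece n K (m : ℤ) = AddMonoidAlgebra.supported K K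
      {d : Fin n →₀ ℕ | d.degree = m} := by
    rw [← homogeneousSubmodule_eq_finsupp_supported]
    ext f
    rw [← isHomogeneous_iff_mem_polyPiece, mem_homogeneousSubmodule]
  have e0 : {d : Fin n →₀ ℕ | d.degree = m} ≃ {P : Fin n → ℕ // ∑ i, P i = m} :=
    Finsupp.equivFunOnFinite.subtypeEquiv (fun d => by
      simp [Finsupp.degree_eq_sum])
  have e : {d : Fin n →₀ ℕ | d.degree = m} ≃ Sym (Fin n) m :=
    e0.trans (Sym.equivNatSumOfFintype _ _).symm
  have : Fintype {d : Fin n →₀ ℕ | d.degree = m} := Fintype.ofEquiv _ e.symm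
  rw [h1]
  refine (Module.finrank_eq_card_basis
    (basisRestrictSupport K {d : Fin n →₀ ℕ | d.degree = m})).trans ?_
  rw [Fintype.card_congr e, Sym.card_sym_eq_multichoose, Fintype.card_fin]

end

/-! ### Matrices acting on powers of a module, and the Koszul complex -/

section

section MatrixAction

variable {R : Type*} [CommRing R] {ι κ μ ο : Type*} [Fintype κ] [Fintype μ]
  {M N F : Type*} [AddCommGroup M] [Module R M] [AddCommGroup N] [Module R N]
  [AddCommGroup F] [Module R F]

/-- The linear map `M^κ → M^ι` given by a matrix over `R`, for any `R`-module `M`. -/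
def matAct (D : Matrix ι κ R) (M : Type*) [AddCommGroup M] [Module R M] :
    (κ → M) →ₗ[R] (ι → M) where
  toFun v i := ∑ j, D i j • v j
  map_add' u v := by ext i; simp [smul_add, Finset.sum_add_distrib]
  map_smul' c v := by
    ext i
    simp only [Pi.smul_apply, Finset.smul_sum, RingHom.id_apply]
    exact Finset.sum_congr rfl fun j _ => smul_comm _ _ _

lemma matAct_apply (D : Matrix ι κ R) (v : κ → M) (i : ι) :
    matAct D M v i = ∑ j, D i j • v j := rfl

lemma comp_matAct (g : M →ₗ[R] N) (D : Matrix ι κ R) (v : κ → M) :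
    (fun i => g (matAct D M v i)) = matAct D N (fun j => g (v j)) := by
  ext i
  simp [matAct_apply]

lemma matAct_matAct (D : Matrix ι κ R) (E : Matrix κ μ R) (v : μ → M) :
    matAct D M (matAct E M v) = matAct (D * E) M v := by
  ext i
  simp only [matAct_apply, Finset.smul_sum, Matrix.mul_apply, Finset.sum_smul, smul_smul]
  exact Finset.sum_comm

lemma matAct_zero (v : κ → M) : matAct (0 : Matrix ι κ R) M v = 0 := by
  ext i; simp [matAct_apply]

lemma exists_comp_eq {τ : Type*} {g : F →ₗ[R] M} (hg : Function.Surjective g) (m : τ → M) :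
    ∃ f : τ → F, (fun k => g (f k)) = m :=
  ⟨fun k => (hg (m k)).choose, funext fun k => (hg (m k)).choose_spec⟩

lemma exists_comp_eq_of_exact {τ : Type*} {i : N →ₗ[R] F} {g : F →ₗ[R] M}
    (hex : Function.Exact i g) (f : τ → F) (hf : ∀ k, g (f k) = 0) :
    ∃ u : τ → N, (fun k => i (u k)) = f :=
  ⟨fun k => ((hex (f k)).1 (hf k)).choose, funext fun k => ((hex (f k)).1 (hf k)).choose_spec⟩

/-- The homology at `M^κ` of `M^μ → M^κ → M^ι`, the maps being given by matrices `E` and `D`. -/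
abbrev matHomology (E : Matrix κ μ R) (D : Matrix ι κ R) (M : Type*) [AddCommGroup M]
    [Module R M] : Type _ :=
  LinearMap.ker (matAct D M) ⧸
    (LinearMap.range (matAct E M)).comap (LinearMap.ker (matAct D M)).subtype

/-- Dimension shifting: for a short exact sequence `0 → N → F → M → 0` such that `F` has no homology
in the two relevant places, the connecting homomorphism is an isomorphism. -/
lemma nonempty_matHomology_equiv [Fintype ι] {E : Matrix κ μ R} {D : Matrix ι κ R}
    {D' : Matrix ο ι R} (hD : D' * D = 0) {i : N →ₗ[R] F} {g : F →ₗ[R] M}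
    (hi : Function.Injective i) (hg : Function.Surjective g) (hex : Function.Exact i g)
    (hDE : D * E = 0) (h1 : ∀ v, matAct D F v = 0 → ∃ w, matAct E F w = v)
    (h2 : ∀ v, matAct D' N v = 0 → ∃ w, matAct D F w = fun k => i (v k)) :
    Nonempty (matHomology E D M ≃ₗ[R] matHomology D D' N) := by
  -- `W` consists of the pairs `(f, v)` such that `v` is the boundary of the chain `f` of `F`
  let W : Submodule R ((κ → F) × (ι → N)) :=
    LinearMap.ker ((matAct D F).comp (LinearMap.fst R _ _) -
      (i.compLeft ι).comp (LinearMap.snd R _ _))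
  have hW : ∀ w : W, matAct D F w.1.1 = fun k => i (w.1.2 k) := fun w =>
    sub_eq_zero.1 w.2
  have hgi : ∀ x, g (i x) = 0 := fun x => (hex (i x)).2 ⟨x, rfl⟩
  let a₀ : W →ₗ[R] LinearMap.ker (matAct D M) :=
    (((g.compLeft κ).comp (LinearMap.fst R _ _)).comp W.subtype).codRestrict _ (by
      intro w
      rw [LinearMap.mem_ker]
      refine (comp_matAct g D w.1.1).symm.trans ?_
      rw [hW]
      ext k
      exact hgi _)
  let b₀ : W →ₗ[R] LinearMap.ker (matAct D' N) :=
    ((LinearMap.snd R _ _).comp W.subtype).codRestrict _ (by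
      intro w
      rw [LinearMap.mem_ker]
      ext k
      apply hi
      refine (congrFun (comp_matAct i D' w.1.2) k).trans ?_
      rw [← hW, matAct_matAct, hD, matAct_zero]
      simp)
  let a := (Submodule.mkQ ((LinearMap.range (matAct E M)).comap
    (LinearMap.ker (matAct D M)).subtype)).comp a₀
  let b := (Submodule.mkQ ((LinearMap.range (matAct D N)).comap
    (LinearMap.ker (matAct D' N)).subtype)).comp b₀
  have ha : Function.Surjective a := by
    refine (Submodule.mkQ_surjective _).comp ?_
    rintro ⟨m, hm⟩
    obtain ⟨f, rfl⟩ := exists_comp_eq hg m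
    obtain ⟨v, hv⟩ := exists_comp_eq_of_exact hex (matAct D F f) (fun k => by
      rw [LinearMap.mem_ker, ← comp_matAct] at hm
      exact congrFun hm k)
    exact ⟨⟨(f, v), sub_eq_zero.2 hv.symm⟩, rfl⟩
  have hb : Function.Surjective b := by
    refine (Submodule.mkQ_surjective _).comp ?_
    rintro ⟨v, hv⟩
    obtain ⟨f, hf⟩ := h2 v hv
    exact ⟨⟨(f, v), sub_eq_zero.2 hf⟩, rfl⟩
  have hab : LinearMap.ker a = LinearMap.ker b := by
    ext w
    have hA : w ∈ LinearMap.ker a ↔ ∃ y, matAct E M y = fun k => g (w.1.1 k) := by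
      rw [LinearMap.mem_ker]
      exact Submodule.Quotient.mk_eq_zero _
    have hB : w ∈ LinearMap.ker b ↔ ∃ y, matAct D N y = w.1.2 := by
      rw [LinearMap.mem_ker]
      exact Submodule.Quotient.mk_eq_zero _
    rw [hA, hB]
    constructor
    · rintro ⟨y, hy⟩
      obtain ⟨y', rfl⟩ := exists_comp_eq hg y
      obtain ⟨u, hu⟩ := exists_comp_eq_of_exact hex (w.1.1 - matAct E F y') (fun k => by
        have := congrFun (comp_matAct g E y') k
        rw [hy] at this
        simpa [sub_eq_zero] using this.symm)
      refine ⟨u, ?_⟩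
      ext k
      apply hi
      refine (congrFun (comp_matAct i D u) k).trans ?_
      rw [hu, map_sub, matAct_matAct, hDE, matAct_zero, sub_zero, hW]
    · rintro ⟨u, hu⟩
      obtain ⟨y, hy⟩ := h1 (w.1.1 - fun k => i (u k)) (by
        rw [map_sub, ← comp_matAct, hu, hW, sub_self])
      refine ⟨fun k => g (y k), ?_⟩
      rw [← comp_matAct, hy]
      ext k
      simp [hgi]
  exact ⟨(a.quotKerEquivOfSurjective ha).symm.trans
    ((Submodule.quotEquivOfEq _ _ hab).trans (b.quotKerEquivOfSurjective hb))⟩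

end MatrixAction

section KoszulMatrices

variable {R : Type*} [CommRing R]

/-- The differential `K₁ → K₀` of the Koszul complex on `x₀, …, x₃`, up to signs. -/
def koszul1 (x : Fin 4 → R) : Matrix (Fin 1) (Fin 4) R :=
  !![x 0, -x 1, -x 2, -x 3]

/-- The differential `K₂ → K₁` of the Koszul complex on `x₀, …, x₃`. With `p = (x₁, x₂, x₃)` it is
`(u, w) ↦ (p ⬝ u, x₀ u - p ⨯ w)`. -/
def koszul2 (x : Fin 4 → R) : Matrix (Fin 4) (Fin 6) R :=
  !![x 1, x 2, x 3, 0, 0, 0;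
     x 0, 0, 0, 0, x 3, -x 2;
     0, x 0, 0, -x 3, 0, x 1;
     0, 0, x 0, x 2, -x 1, 0]

/-- The differential `K₃ → K₂` of the Koszul complex on `x₀, …, x₃`. With `p = (x₁, x₂, x₃)` it is
`(s, r) ↦ (p ⨯ r, s p + x₀ r)`; the rows are those of the transpose of `koszul2`, with the two
blocks of three rows interchanged. -/
def koszul3 (x : Fin 4 → R) : Matrix (Fin 6) (Fin 4) R :=
  !![0, 0, -x 3, x 2;
     0, x 3, 0, -x 1;
     0, -x 2, x 1, 0;
     x 1, x 0, 0, 0;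
     x 2, 0, x 0, 0;
     x 3, 0, 0, x 0]

/-- The differential `K₄ → K₃` of the Koszul complex on `x₀, …, x₃`, up to signs. -/
def koszul4 (x : Fin 4 → R) : Matrix (Fin 4) (Fin 1) R :=
  !![x 0; -x 1; -x 2; -x 3]

lemma koszul1_mul_koszul2 (x : Fin 4 → R) : koszul1 x * koszul2 x = 0 := by
  ext i j
  fin_cases i; fin_cases j <;>
    simp [koszul1, koszul2, Matrix.mul_apply, Fin.sum_univ_succ] <;> ring

lemma koszul2_mul_koszul3 (x : Fin 4 → R) : koszul2 x * koszul3 x = 0 := by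
  ext i j
  fin_cases i <;> fin_cases j <;>
    simp [koszul3, koszul2, Matrix.mul_apply, Fin.sum_univ_succ] <;> ring

lemma koszul3_mul_koszul4 (x : Fin 4 → R) : koszul3 x * koszul4 x = 0 := by
  ext i j
  fin_cases i <;> fin_cases j <;>
    simp [koszul3, koszul4, Matrix.mul_apply, Fin.sum_univ_succ] <;> ring

variable {M : Type*} [AddCommGroup M] [Module R M]

lemma koszul4_transpose (x : Fin 4 → R) : (koszul1 x).transpose = koszul4 x := by
  ext i j
  fin_cases i <;> fin_cases j <;> rfl

lemma koszul3_submatrix (x : Fin 4 → R) :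
    (koszul2 x).transpose.submatrix ![3, 4, 5, 0, 1, 2] id = koszul3 x := by
  ext i j
  fin_cases i <;> fin_cases j <;> rfl

/-- The regularity of the sequence `x₁, x₂, x₃, x₀`, in terms of elements; the quotient by all four
is not required to be nonzero. -/
structure IsRegularQuadruple (x : Fin 4 → R) : Prop where
  reg₁ : ∀ a, x 1 * a = 0 → a = 0
  reg₂ : ∀ a b, x 2 * a = x 1 * b → ∃ c, a = x 1 * c
  reg₃ : ∀ a b c, x 3 * a = x 1 * b + x 2 * c → ∃ d e, a = x 1 * d + x 2 * e
  reg₀ : ∀ a b c d, x 0 * a = x 1 * b + x 2 * c + x 3 * d →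
    ∃ e f g, a = x 1 * e + x 2 * f + x 3 * g

namespace IsRegularQuadruple

variable {x : Fin 4 → R}

lemma cancel (hx : IsRegularQuadruple x) {a b : R} (h : x 1 * a = x 1 * b) : a = b :=
  sub_eq_zero.1 (hx.reg₁ _ (by rw [mul_sub, h, sub_self]))

/-- Exactness of the Koszul complex on `x₁, x₂, x₃` in degree two. -/
lemma exists_of_cross (hx : IsRegularQuadruple x) {a b c : R} (h3 : x 1 * b = x 2 * a)
    (h2 : x 1 * c = x 3 * a) :
    ∃ f, a = x 1 * f ∧ b = x 2 * f ∧ c = x 3 * f := by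
  obtain ⟨f, rfl⟩ := hx.reg₂ a b h3.symm
  exact ⟨f, rfl, hx.cancel (by rw [h3]; ring), hx.cancel (by rw [h2]; ring)⟩

/-- Exactness of the Koszul complex on `x₁, x₂, x₃` in degree one. -/
lemma exists_of_dot (hx : IsRegularQuadruple x) {a b c : R} (h : x 1 * a + x 2 * b + x 3 * c = 0) :
    ∃ p q s, a = x 2 * s - x 3 * q ∧ b = x 3 * p - x 1 * s ∧ c = x 1 * q - x 2 * p := by
  obtain ⟨d, e, rfl⟩ := hx.reg₃ c (-a) (-b) (by linear_combination h)
  obtain ⟨s, hs⟩ := hx.reg₂ (b + x 3 * e) (-(a + x 3 * d)) (by linear_combination h)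
  refine ⟨-e, d, -s, ?_, by linear_combination hs, by ring⟩
  exact hx.cancel (by linear_combination h - x 2 * hs)

lemma exact₁ (hx : IsRegularQuadruple x) (v : Fin 4 → R) (h : matAct (koszul1 x) R v = 0) :
    ∃ w, matAct (koszul2 x) R w = v := by
  have h0 := congrFun h 0
  simp [matAct_apply, koszul1, Fin.sum_univ_succ] at h0
  obtain ⟨e, f, g, hv⟩ := hx.reg₀ (v 0) (v 1) (v 2) (v 3) (by linear_combination h0)
  rw [hv] at h0
  obtain ⟨p, q, s, h1, h2, h3⟩ := hx.exists_of_dot (a := x 0 * e - v 1) (b := x 0 * f - v 2)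
    (c := x 0 * g - v 3) (by linear_combination h0)
  refine ⟨![e, f, g, p, q, s], ?_⟩
  ext i
  fin_cases i <;> simp [matAct_apply, koszul2, Fin.sum_univ_succ]
  · rw [hv]; ring
  · linear_combination h1
  · linear_combination h2
  · linear_combination h3

lemma exact₂ (hx : IsRegularQuadruple x) (v : Fin 6 → R) (h : matAct (koszul2 x) R v = 0) :
    ∃ w, matAct (koszul3 x) R w = v := by
  have h0 := congrFun h 0
  have h1 := congrFun h 1
  have h2 := congrFun h 2
  have h3 := congrFun h 3
  simp [matAct_apply, koszul2, Fin.sum_univ_succ] at h0 h1 h2 h3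
  obtain ⟨p, q, s, ha, hb, hc⟩ := hx.exists_of_dot (a := v 0) (b := v 1) (c := v 2)
    (by linear_combination h0)
  rw [ha] at h1
  rw [hb] at h2
  rw [hc] at h3
  obtain ⟨f, hf1, hf2, hf3⟩ := hx.exists_of_cross (a := v 3 - x 0 * p) (b := v 4 - x 0 * q)
    (c := v 5 - x 0 * s) (by linear_combination -h3) (by linear_combination h2)
  refine ⟨![f, p, q, s], ?_⟩
  ext i
  fin_cases i <;> simp [matAct_apply, koszul3, Fin.sum_univ_succ]
  · rw [ha]; ring
  · rw [hb]; ring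
  · rw [hc]; ring
  · linear_combination -hf1
  · linear_combination -hf2
  · linear_combination -hf3

lemma exact₃ (hx : IsRegularQuadruple x) (v : Fin 4 → R) (h : matAct (koszul3 x) R v = 0) :
    ∃ w, matAct (koszul4 x) R w = v := by
  have h1 := congrFun h 1
  have h2 := congrFun h 2
  have h3 := congrFun h 3
  have h4 := congrFun h 4
  have h5 := congrFun h 5
  simp [matAct_apply, koszul3, Fin.sum_univ_succ] at h1 h2 h3 h4 h5
  obtain ⟨f, hf1, hf2, hf3⟩ := hx.exists_of_cross (a := v 1) (b := v 2) (c := v 3)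
    (by linear_combination h2) (by linear_combination -h1)
  refine ⟨![-f], ?_⟩
  ext i
  fin_cases i <;> simp [matAct_apply, koszul4]
  · refine hx.cancel ?_
    rw [hf1] at h3
    linear_combination -h3
  · exact hf1.symm
  · exact hf2.symm
  · exact hf3.symm

lemma exact₄ (hx : IsRegularQuadruple x) (v : Fin 1 → R) (h : matAct (koszul4 x) R v = 0) :
    v = 0 := by
  have h1 := congrFun h 1
  simp [matAct_apply, koszul4] at h1
  ext i
  fin_cases i
  exact hx.reg₁ _ h1

end IsRegularQuadruple

/-- Exactness over `R` is inherited by finite free modules. -/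
lemma exists_matAct_of_free {ι κ μ : Type*} [Fintype κ] [Fintype μ] {E : Matrix κ μ R}
    {D : Matrix ι κ R} (h : ∀ v, matAct D R v = 0 → ∃ w, matAct E R w = v) (r : ℕ)
    (v : κ → Fin r → R) (hv : matAct D (Fin r → R) v = 0) :
    ∃ w, matAct E (Fin r → R) w = v := by
  have : ∀ p, ∃ w, matAct E R w = fun k => v k p := fun p => h _ (by
    ext i
    have := congrFun (congrFun hv i) p
    simpa [matAct_apply] using this)
  choose w hw using this
  refine ⟨fun m p => w p m, ?_⟩
  ext k p
  have := congrFun (hw p) k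
  simpa [matAct_apply] using this

end KoszulMatrices

end

/-! ### Koszul homology over the polynomial ring -/

section

variable {K : Type*} [Field K]

/-- A variable is a nonzerodivisor modulo an ideal generated by other variables. -/
lemma mem_span_X_of_X_mul_mem {s : Set (Fin 4)} {i : Fin 4} (hi : i ∉ s) {a : PolyRing 4 K}
    (h : X i * a ∈ Ideal.span (X '' s : Set (PolyRing 4 K))) :
    a ∈ Ideal.span (X '' s : Set (PolyRing 4 K)) := by
  rw [mem_ideal_span_X_image] at h ⊢
  intro m hm
  obtain ⟨k, hk, hk0⟩ := h (Finsupp.single i 1 + m) (by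
    rw [mem_support_iff] at hm ⊢
    rwa [add_comm, mul_comm, coeff_mul_X])
  refine ⟨k, hk, ?_⟩
  have hki : i ≠ k := fun h => hi (h ▸ hk)
  simpa [Finsupp.single_apply, hki] using hk0

lemma isRegularQuadruple_X : IsRegularQuadruple (X : Fin 4 → PolyRing 4 K) where
  reg₁ a h := (mul_eq_zero.1 h).resolve_left (X_ne_zero _)
  reg₂ a b h := by
    have := mem_span_X_of_X_mul_mem (K := K) (s := {1}) (i := 2) (a := a) (by decide) (by
      rw [h]
      exact Ideal.mul_mem_right _ _ (Ideal.subset_span ⟨1, by simp, rfl⟩))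
    rw [Set.image_singleton, Ideal.mem_span_singleton'] at this
    obtain ⟨c, hc⟩ := this
    exact ⟨c, by rw [← hc, mul_comm]⟩
  reg₃ a b c h := by
    have := mem_span_X_of_X_mul_mem (K := K) (s := {1, 2}) (i := 3) (a := a) (by decide) (by
      rw [h]
      exact add_mem (Ideal.mul_mem_right _ _ (Ideal.subset_span ⟨1, by simp, rfl⟩))
        (Ideal.mul_mem_right _ _ (Ideal.subset_span ⟨2, by simp, rfl⟩)))
    rw [Set.image_pair, Ideal.mem_span_pair] at this
    obtain ⟨d, e, h⟩ := this
    exact ⟨d, e, by rw [← h]; ring⟩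
  reg₀ a b c d h := by
    have := mem_span_X_of_X_mul_mem (K := K) (s := {1, 2, 3}) (i := 0) (a := a) (by decide) (by
      rw [h]
      exact add_mem (add_mem (Ideal.mul_mem_right _ _ (Ideal.subset_span ⟨1, by simp, rfl⟩))
        (Ideal.mul_mem_right _ _ (Ideal.subset_span ⟨2, by simp, rfl⟩)))
        (Ideal.mul_mem_right _ _ (Ideal.subset_span ⟨3, by simp, rfl⟩)))
    rw [Set.image_insert_eq, Set.image_pair, Ideal.mem_span_insert] at this
    obtain ⟨e, z, hz, h⟩ := this
    obtain ⟨f, g, h'⟩ := Ideal.mem_span_pair.1 hz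
    exact ⟨e, f, g, by rw [h, ← h']; ring⟩

section KoszulHomology

variable (K) (M : Type*) [AddCommGroup M] [Module (PolyRing 4 K) M]

/-- The Koszul homology `H₀(x; M) = M/(x₁, …, x₄)M`. -/
abbrev KoszulH0 : Type _ := matHomology (koszul1 (X : Fin 4 → PolyRing 4 K))
  (0 : Matrix (Fin 0) (Fin 1) (PolyRing 4 K)) M

/-- The Koszul homology `H₁(x; M)`. -/
abbrev KoszulH1 : Type _ := matHomology (koszul2 (X : Fin 4 → PolyRing 4 K)) (koszul1 X) M

/-- The Koszul homology `H₂(x; M)`. -/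
abbrev KoszulH2 : Type _ := matHomology (koszul3 (X : Fin 4 → PolyRing 4 K)) (koszul2 X) M

/-- The Koszul homology `H₃(x; M)`. -/
abbrev KoszulH3 : Type _ := matHomology (koszul4 (X : Fin 4 → PolyRing 4 K)) (koszul3 X) M

/-- The Koszul homology `H₄(x; M)`, the submodule of `M` killed by the variables. -/
abbrev KoszulH4 : Type _ := matHomology (0 : Matrix (Fin 1) (Fin 0) (PolyRing 4 K)) (koszul4 X) M

end KoszulHomology

/-- The vectors of `S^r` with entries in the maximal ideal are the boundaries in degree zero. -/
lemma mem_maxIdeal_iff_exists_koszul1 {r : ℕ} (v : Fin r → PolyRing 4 K) :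
    (∀ p, v p ∈ maxIdeal 4 K) ↔
      ∃ y, matAct (koszul1 (X : Fin 4 → PolyRing 4 K)) (Fin r → PolyRing 4 K) y = fun _ => v := by
  constructor
  · intro h
    simp only [maxIdeal, Ideal.span, Submodule.mem_span_range_iff_exists_fun] at h
    choose c hc using h
    refine ⟨![fun p => c p 0, fun p => -c p 1, fun p => -c p 2, fun p => -c p 3], ?_⟩
    ext1 i
    funext p
    fin_cases i
    rw [← hc p]
    simp [matAct_apply, koszul1, Fin.sum_univ_succ]
    ring
  · rintro ⟨y, hy⟩ p
    have := congrFun (congrFun hy 0) p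
    rw [← this]
    have hX : ∀ i, (X i : PolyRing 4 K) ∈ maxIdeal 4 K := fun i => Ideal.subset_span ⟨i, rfl⟩
    simp only [matAct_apply, koszul1, Fin.sum_univ_succ]
    simp
    refine add_mem (Ideal.mul_mem_right _ _ (hX _)) (add_mem ?_ (add_mem ?_ ?_)) <;>
    exact neg_mem (Ideal.mul_mem_right _ _ (hX _))

section Shift

lemma exists_matAct_of_injective {N : Type*} [AddCommGroup N] [Module (PolyRing 4 K) N] {r : ℕ}
    {i : N →ₗ[PolyRing 4 K] (Fin r → PolyRing 4 K)} {ι κ μ : Type*} [Fintype ι] [Fintype κ]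
    [Fintype μ] {E : Matrix κ μ (PolyRing 4 K)} {D : Matrix ι κ (PolyRing 4 K)}
    (h : ∀ v, matAct D (PolyRing 4 K) v = 0 → ∃ w, matAct E (PolyRing 4 K) w = v)
    (v : κ → N) (hv : matAct D N v = 0) :
    ∃ w, matAct E (Fin r → PolyRing 4 K) w = fun k => i (v k) := by
  refine exists_matAct_of_free h r _ ?_
  rw [← comp_matAct, hv]
  ext1 k
  exact map_zero i

variable {M N : Type*} [AddCommGroup M] [Module (PolyRing 4 K) M] [Module K M]
  [IsScalarTower K (PolyRing 4 K) M] [AddCommGroup N] [Module (PolyRing 4 K) N] [Module K N]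
  [IsScalarTower K (PolyRing 4 K) N] {r : ℕ} {i : N →ₗ[PolyRing 4 K] (Fin r → PolyRing 4 K)}
  {g : (Fin r → PolyRing 4 K) →ₗ[PolyRing 4 K] M}

lemma finrank_eq_of_nonempty_equiv (h : Nonempty (M ≃ₗ[PolyRing 4 K] N)) :
    Module.finrank K M = Module.finrank K N :=
  (h.some.restrictScalars K).finrank_eq

lemma finrank_koszulH1 (hi : Function.Injective i) (hg : Function.Surjective g)
    (hex : Function.Exact i g) (hm : ∀ n p, i n p ∈ maxIdeal 4 K) :
    Module.finrank K (KoszulH1 K M) = Module.finrank K (KoszulH0 K N) :=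
  finrank_eq_of_nonempty_equiv <| nonempty_matHomology_equiv (Matrix.zero_mul _) hi hg hex
    (koszul1_mul_koszul2 _) (exists_matAct_of_free isRegularQuadruple_X.exact₁ r) (fun v _ => by
      obtain ⟨y, hy⟩ := (mem_maxIdeal_iff_exists_koszul1 (i (v 0))).1 (hm _)
      exact ⟨y, by rw [hy]; ext1 k; rw [Subsingleton.elim k 0]⟩)

lemma finrank_koszulH2 (hi : Function.Injective i) (hg : Function.Surjective g)
    (hex : Function.Exact i g) :
    Module.finrank K (KoszulH2 K M) = Module.finrank K (KoszulH1 K N) :=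
  finrank_eq_of_nonempty_equiv <| nonempty_matHomology_equiv (koszul1_mul_koszul2 _) hi hg hex
    (koszul2_mul_koszul3 _) (exists_matAct_of_free isRegularQuadruple_X.exact₂ r)
    (exists_matAct_of_injective isRegularQuadruple_X.exact₁)

lemma finrank_koszulH3 (hi : Function.Injective i) (hg : Function.Surjective g)
    (hex : Function.Exact i g) :
    Module.finrank K (KoszulH3 K M) = Module.finrank K (KoszulH2 K N) :=
  finrank_eq_of_nonempty_equiv <| nonempty_matHomology_equiv (koszul2_mul_koszul3 _) hi hg hex
    (koszul3_mul_koszul4 _) (exists_matAct_of_free isRegularQuadruple_X.exact₃ r)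
    (exists_matAct_of_injective isRegularQuadruple_X.exact₂)

lemma exists_matAct_zero_of_koszul4 (v : Fin 1 → PolyRing 4 K)
    (hv : matAct (koszul4 (X : Fin 4 → PolyRing 4 K)) (PolyRing 4 K) v = 0) :
    ∃ w, matAct (0 : Matrix (Fin 1) (Fin 0) (PolyRing 4 K)) (PolyRing 4 K) w = v :=
  ⟨0, by rw [isRegularQuadruple_X.exact₄ v hv, map_zero]⟩

lemma finrank_koszulH4 (hi : Function.Injective i) (hg : Function.Surjective g)
    (hex : Function.Exact i g) :
    Module.finrank K (KoszulH4 K M) = Module.finrank K (KoszulH3 K N) :=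
  finrank_eq_of_nonempty_equiv <| nonempty_matHomology_equiv (koszul3_mul_koszul4 _) hi hg hex
    (Matrix.mul_zero _) (exists_matAct_of_free exists_matAct_zero_of_koszul4 r)
    (exists_matAct_of_injective isRegularQuadruple_X.exact₃)

/-- The top Koszul homology of a torsion-free module vanishes. -/
lemma finrank_koszulH4_of_injective (hi : Function.Injective i) :
    Module.finrank K (KoszulH4 K N) = 0 := by
  have : Subsingleton (LinearMap.ker (matAct (koszul4 (X : Fin 4 → PolyRing 4 K)) N)) := by
    refine ⟨fun a b => ?_⟩
    rw [← sub_eq_zero]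
    obtain ⟨v, hv⟩ := a - b
    obtain ⟨w, hw⟩ := exists_matAct_of_injective (i := i) exists_matAct_zero_of_koszul4 v hv
    ext k
    apply hi
    have := congrFun hw k
    rw [matAct_zero] at this
    rw [← this]
    simp
  have : Subsingleton (KoszulH4 K N) := (Submodule.mkQ_surjective _).subsingleton
  exact Module.finrank_zero_of_subsingleton

/-- If `S^r → M` is surjective with kernel in `mS^r`, then `M/mM` has dimension `r`. -/
lemma finrank_koszulH0 (hg : Function.Surjective g)
    (hm : ∀ v, g v = 0 → ∀ p, v p ∈ maxIdeal 4 K) :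
    Module.finrank K (KoszulH0 K M) = r := by
  have hker : ∀ m : M, (fun _ : Fin 1 => m) ∈
      LinearMap.ker (matAct (0 : Matrix (Fin 0) (Fin 1) (PolyRing 4 K)) M) := fun m =>
    matAct_zero _
  let a₀ : (Fin r → PolyRing 4 K) →ₗ[PolyRing 4 K]
      LinearMap.ker (matAct (0 : Matrix (Fin 0) (Fin 1) (PolyRing 4 K)) M) :=
    (LinearMap.pi fun _ => g).codRestrict _ fun v => hker (g v)
  let a := ((Submodule.mkQ ((LinearMap.range (matAct (koszul1 X) M)).comap
    (LinearMap.ker (matAct (0 : Matrix (Fin 0) (Fin 1) (PolyRing 4 K)) M)).subtype)).comp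
      a₀).restrictScalars K
  let b : (Fin r → PolyRing 4 K) →ₗ[K] (Fin r → K) :=
    LinearMap.compLeft (aeval (R := K) (fun _ : Fin 4 => (0 : K))).toLinearMap (Fin r)
  have hb0 : ∀ v p, b v p = constantCoeff (v p) := fun v p => by
    simp only [b, LinearMap.compLeft_apply, Function.comp_apply, AlgHom.toLinearMap_apply]
    rw [show (fun _ : Fin 4 => (0 : K)) = 0 from rfl, aeval_zero]
    rfl
  have ha : Function.Surjective a := by
    refine (Submodule.mkQ_surjective _).comp ?_
    rintro ⟨m, hm'⟩
    obtain ⟨v, hv⟩ := hg (m 0)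
    exact ⟨v, Subtype.ext (funext fun k => by rw [Subsingleton.elim k 0]; exact hv)⟩
  have hb : Function.Surjective b := fun w => ⟨fun p => C (w p), by ext p; rw [hb0]; simp⟩
  have hab : LinearMap.ker a = LinearMap.ker b := by
    ext v
    have hA : v ∈ LinearMap.ker a ↔
        ∃ y, matAct (koszul1 (X : Fin 4 → PolyRing 4 K)) M y = fun _ => g v := by
      rw [LinearMap.mem_ker]
      exact Submodule.Quotient.mk_eq_zero _
    have hB : v ∈ LinearMap.ker b ↔ ∀ p, v p ∈ maxIdeal 4 K := by
      rw [LinearMap.mem_ker, funext_iff]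
      simp only [hb0, mem_maxIdeal, Pi.zero_apply]
    rw [hA, hB]
    constructor
    · rintro ⟨y, hy⟩ p
      obtain ⟨y', rfl⟩ := exists_comp_eq hg y
      rw [← comp_matAct] at hy
      set u := matAct (koszul1 (X : Fin 4 → PolyRing 4 K)) (Fin r → PolyRing 4 K) y' 0 with hu
      have h1 := hm (v - u) (by rw [map_sub, ← congrFun hy 0, sub_self]) p
      have h2 := (mem_maxIdeal_iff_exists_koszul1 u).2
        ⟨y', by ext1 k; rw [Subsingleton.elim k 0]⟩ p
      simpa using add_mem h1 h2
    · intro h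
      obtain ⟨y, hy⟩ := (mem_maxIdeal_iff_exists_koszul1 v).1 h
      exact ⟨fun k => g (y k), by rw [← comp_matAct, hy]⟩
  have e := (a.quotKerEquivOfSurjective ha).symm.trans
    ((Submodule.quotEquivOfEq _ _ hab).trans (b.quotKerEquivOfSurjective hb))
  rw [e.finrank_eq, Module.finrank_fin_fun]

end Shift

/-- `H₄(x; S/I)` is the socle of `S/I`. -/
lemma finrank_koszulH4_quotient (I : Ideal (PolyRing 4 K)) :
    Module.finrank K (KoszulH4 K (PolyRing 4 K ⧸ I)) = Module.finrank K (socle I) := by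
  have hsm : ∀ (f : PolyRing 4 K) (a : PolyRing 4 K ⧸ I), f • a = Ideal.Quotient.mk I f * a :=
    fun f a => Algebra.smul_def f a
  have hmem : ∀ v : Fin 1 → PolyRing 4 K ⧸ I,
      matAct (koszul4 (X : Fin 4 → PolyRing 4 K)) (PolyRing 4 K ⧸ I) v = 0 ↔ v 0 ∈ socle I := by
    intro v
    constructor
    · intro h f hf
      rw [maxIdeal, Ideal.span, Submodule.mem_span_range_iff_exists_fun] at hf
      obtain ⟨c, rfl⟩ := hf
      have h0 := congrFun h 0
      have h1 := congrFun h 1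
      have h2 := congrFun h 2
      have h3 := congrFun h 3
      simp [matAct_apply, koszul4] at h0 h1 h2 h3
      rw [hsm] at h0 h1 h2 h3
      simp [Fin.sum_univ_succ, add_mul, mul_assoc, h0, h1, h2, h3]
    · intro h
      have hX : ∀ i, Ideal.Quotient.mk I (X i) * v 0 = 0 := fun i =>
        h _ (Ideal.subset_span ⟨i, rfl⟩)
      ext k
      fin_cases k <;> simp [matAct_apply, koszul4] <;> rw [hsm, hX]
  have hbot : (LinearMap.range (matAct (0 : Matrix (Fin 1) (Fin 0) (PolyRing 4 K))
      (PolyRing 4 K ⧸ I))).comap (LinearMap.ker (matAct (koszul4 X)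
        (PolyRing 4 K ⧸ I))).subtype = ⊥ := by
    rw [eq_bot_iff]
    rintro v ⟨w, hw⟩
    rw [matAct_zero] at hw
    exact Subtype.ext hw.symm
  have e1 := ((Submodule.quotEquivOfEqBot _ hbot).restrictScalars K).finrank_eq
  rw [e1]
  refine LinearEquiv.finrank_eq (LinearEquiv.ofBijective
    ((((LinearMap.proj 0 : (Fin 1 → PolyRing 4 K ⧸ I) →ₗ[PolyRing 4 K] _).restrictScalars K).comp
      ((LinearMap.ker (matAct (koszul4 X) (PolyRing 4 K ⧸ I))).subtype.restrictScalars
        K)).codRestrict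
      (socle I) fun v => (hmem v.1).1 v.2) ⟨?_, ?_⟩)
  · intro a b hab
    ext k
    rw [Subsingleton.elim k 0]
    exact congrArg Subtype.val hab
  · rintro ⟨a, ha⟩
    exact ⟨⟨fun _ => a, (hmem _).2 ha⟩, rfl⟩

end

/-! ### Ranks in a minimal resolution as Koszul homology -/

section

variable {K : Type*} [Field K]

/-- The presentation `S → S/I`, as a map from the free module of rank one. -/
def quotPresentation {n : ℕ} (I : Ideal (PolyRing n K)) :
    (Fin 1 → PolyRing n K) →ₗ[PolyRing n K] (PolyRing n K ⧸ I) :=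
  I.mkQ.comp (LinearMap.proj 0)

lemma quotPresentation_apply {n : ℕ} (I : Ideal (PolyRing n K)) (v : Fin 1 → PolyRing n K) :
    quotPresentation I v = Ideal.Quotient.mk I (v 0) := rfl

lemma quotPresentation_surjective {n : ℕ} (I : Ideal (PolyRing n K)) :
    Function.Surjective (quotPresentation I) := fun a => by
  obtain ⟨f, rfl⟩ := Ideal.Quotient.mk_surjective a
  exact ⟨fun _ => f, rfl⟩

lemma quotPresentation_eq_zero {n : ℕ} {I : Ideal (PolyRing n K)} {v : Fin 1 → PolyRing n K} :
    quotPresentation I v = 0 ↔ v 0 ∈ I := by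
  rw [quotPresentation_apply, Ideal.Quotient.eq_zero_iff_mem]

lemma finrank_koszulH0_quotient {I : Ideal (PolyRing 4 K)} (hI : I ≤ maxIdeal 4 K) :
    Module.finrank K (KoszulH0 K (PolyRing 4 K ⧸ I)) = 1 :=
  finrank_koszulH0 (quotPresentation_surjective I) fun v hv p => by
    rw [Subsingleton.elim p 0]
    exact hI (quotPresentation_eq_zero.1 hv)

lemma finrank_koszulH1_quotient {I : Ideal (PolyRing 4 K)} (hI : I ≤ maxIdeal 4 K) :
    Module.finrank K (KoszulH1 K (PolyRing 4 K ⧸ I)) = Module.finrank K (KoszulH0 K I) := by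
  refine finrank_koszulH1 (i := LinearMap.pi fun _ : Fin 1 => Submodule.subtype I)
    (g := quotPresentation I) ?_ (quotPresentation_surjective I) ?_ ?_
  · intro a b h
    exact Subtype.ext (congrFun h 0)
  · intro v
    rw [quotPresentation_eq_zero]
    constructor
    · intro h
      exact ⟨⟨_, h⟩, by ext1 k; rw [Subsingleton.elim k 0]; rfl⟩
    · rintro ⟨a, rfl⟩
      exact a.2
  · intro a _
    exact hI a.2

namespace MinimalGradedFreeResolution

variable {I : Ideal (PolyRing 4 K)} (F : MinimalGradedFreeResolution I)

lemma exact_subtype_rangeRestrict (i : ℕ) :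
    Function.Exact (LinearMap.range (F.d (i + 1))).subtype (F.d i).rangeRestrict := by
  intro v
  rw [Subtype.ext_iff]
  exact (F.exact_succ i v).trans (by simp)

lemma exact_subtype_aug :
    Function.Exact (LinearMap.range (F.d 0)).subtype F.aug := fun v =>
  (F.exact_zero v).trans (by simp)

lemma range_le_maxIdeal (i : ℕ) (x : LinearMap.range (F.d i)) (p : Fin (F.rank i)) :
    (x : Fin (F.rank i) → PolyRing 4 K) p ∈ maxIdeal 4 K := by
  obtain ⟨_, v, rfl⟩ := x
  exact F.minimal i v p

lemma rank_zero : F.rank 0 = Module.finrank K (KoszulH0 K (PolyRing 4 K ⧸ I)) :=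
  (finrank_koszulH0 F.aug_surjective fun v hv p => by
    obtain ⟨w, rfl⟩ := (F.exact_zero v).1 hv
    exact F.minimal 0 w p).symm

lemma rank_succ (i : ℕ) :
    F.rank (i + 1) = Module.finrank K (KoszulH0 K (LinearMap.range (F.d i))) :=
  (finrank_koszulH0 (F.d i).surjective_rangeRestrict fun v hv p => by
    obtain ⟨w, rfl⟩ := (F.exact_subtype_rangeRestrict i v).1 hv
    exact F.range_le_maxIdeal _ w p).symm

lemma rank_one : F.rank 1 = Module.finrank K (KoszulH1 K (PolyRing 4 K ⧸ I)) := by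
  rw [F.rank_succ, finrank_koszulH1 (Submodule.subtype_injective _) F.aug_surjective
    F.exact_subtype_aug (F.range_le_maxIdeal 0)]

lemma rank_add_two (i : ℕ) :
    F.rank (i + 2) = Module.finrank K (KoszulH1 K (LinearMap.range (F.d i))) := by
  rw [F.rank_succ, finrank_koszulH1 (Submodule.subtype_injective _)
    (F.d i).surjective_rangeRestrict (F.exact_subtype_rangeRestrict i) (F.range_le_maxIdeal _)]

lemma rank_add_three (i : ℕ) :
    F.rank (i + 3) = Module.finrank K (KoszulH2 K (LinearMap.range (F.d i))) := by
  rw [F.rank_add_two (i + 1), finrank_koszulH2 (Submodule.subtype_injective _)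
    (F.d i).surjective_rangeRestrict (F.exact_subtype_rangeRestrict i)]

lemma rank_add_four (i : ℕ) :
    F.rank (i + 4) = Module.finrank K (KoszulH3 K (LinearMap.range (F.d i))) := by
  rw [F.rank_add_three (i + 1), finrank_koszulH3 (Submodule.subtype_injective _)
    (F.d i).surjective_rangeRestrict (F.exact_subtype_rangeRestrict i)]

/-- Hilbert's syzygy theorem: the minimal resolution has length at most four. -/
lemma rank_add_five (i : ℕ) : F.rank (i + 5) = 0 := by
  rw [F.rank_add_four (i + 1), ← finrank_koszulH4 (Submodule.subtype_injective _)
    (F.d i).surjective_rangeRestrict (F.exact_subtype_rangeRestrict i)]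
  exact finrank_koszulH4_of_injective (Submodule.subtype_injective _)

lemma rank_three : F.rank 3 = Module.finrank K (KoszulH3 K (PolyRing 4 K ⧸ I)) := by
  rw [F.rank_add_three 0, finrank_koszulH3 (Submodule.subtype_injective _) F.aug_surjective
    F.exact_subtype_aug]

lemma rank_four : F.rank 4 = Module.finrank K (socle I) := by
  rw [F.rank_add_four 0, ← finrank_koszulH4_quotient,
    finrank_koszulH4 (Submodule.subtype_injective _) F.aug_surjective F.exact_subtype_aug]

end MinimalGradedFreeResolution

end

/-! ### Artin Gorenstein algebras: symmetry and self-duality -/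

section

variable {K : Type*} [Field K]

section Gorenstein

variable {n : ℕ} {I : Ideal (PolyRing n K)}

lemma IsArtinGorenstein.hcomp_mem (hAG : IsArtinGorenstein I) {f : PolyRing n K} (hf : f ∈ I)
    (j : ℤ) : hcomp j f ∈ I := by
  rcases lt_or_ge j 0 with h | h
  · rw [hcomp_neg h]; exact I.zero_mem
  · obtain ⟨m, rfl⟩ := Int.eq_ofNat_of_zero_le h
    rw [hcomp_natCast]
    exact hAG.homogeneous f hf m

lemma quotPiece_eq_bot_iff {j : ℤ} : quotPiece I j = ⊥ ↔ ∀ f ∈ polyPiece n K j, f ∈ I := by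
  rw [quotPiece, ← LinearMap.le_ker_iff_map]
  refine forall₂_congr fun f _ => ?_
  rw [LinearMap.mem_ker]
  exact Ideal.Quotient.eq_zero_iff_mem

lemma mk_mem_quotPiece {j : ℤ} {f : PolyRing n K} (hf : f ∈ polyPiece n K j) :
    Ideal.Quotient.mk I f ∈ quotPiece I j := ⟨f, hf, rfl⟩

lemma mk_mem_socle_iff {f : PolyRing n K} :
    Ideal.Quotient.mk I f ∈ socle I ↔ ∀ i, f * X i ∈ I := by
  constructor
  · intro h i
    have := h (X i) (Ideal.subset_span ⟨i, rfl⟩)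
    rwa [← map_mul, Ideal.Quotient.eq_zero_iff_mem, mul_comm] at this
  · intro h g hg
    rw [maxIdeal, Ideal.span, Submodule.mem_span_range_iff_exists_fun] at hg
    obtain ⟨c, rfl⟩ := hg
    rw [← map_mul, Ideal.Quotient.eq_zero_iff_mem, Finset.sum_mul]
    refine Ideal.sum_mem _ fun i _ => ?_
    rw [smul_eq_mul, mul_assoc, mul_comm (X i)]
    exact Ideal.mul_mem_left _ _ (h i)

variable {s : ℕ}

lemma HasSocleDegree.mem_of_lt (h : HasSocleDegree I s) {j : ℤ} (hj : (s : ℤ) < j)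
    {f : PolyRing n K} (hf : f ∈ polyPiece n K j) : f ∈ I := by
  by_contra hfI
  have : j ≤ s := h.2 (show quotPiece I j ≠ ⊥ from fun hb => hfI (quotPiece_eq_bot_iff.1 hb f hf))
  omega

lemma HasSocleDegree.exists_notMem (h : HasSocleDegree I s) :
    ∃ f ∈ polyPiece n K s, f ∉ I := by
  have h1 : quotPiece I s ≠ ⊥ := h.1
  rw [ne_eq, quotPiece_eq_bot_iff] at h1
  push Not at h1
  exact h1

lemma IsArtinGorenstein.le_maxIdeal (hAG : IsArtinGorenstein I) (h : HasSocleDegree I s) :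
    I ≤ maxIdeal n K := by
  intro f hf
  by_contra hm
  rw [mem_maxIdeal] at hm
  have h0 := hAG.hcomp_mem hf 0
  rw [mem_polyPiece_zero (ArtinGor.hcomp_mem 0 f)] at h0
  rw [constantCoeff_hcomp_zero] at h0
  have htop : I = ⊤ := Ideal.eq_top_of_isUnit_mem _ h0 ((Ne.isUnit hm).map C)
  obtain ⟨g, _, hg⟩ := h.exists_notMem
  exact hg (htop ▸ Submodule.mem_top)

lemma HasSocleDegree.finite (h : HasSocleDegree I s) :
    Module.Finite K (PolyRing n K ⧸ I) := by
  have htop : (⊤ : Submodule K (PolyRing n K ⧸ I)) =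
      ⨆ k ∈ Finset.range (s + 1), quotPiece I (k : ℤ) := by
    refine le_antisymm (fun a _ => ?_) le_top
    obtain ⟨f, rfl⟩ := Ideal.Quotient.mk_surjective a
    rw [← sum_hcomp f, map_sum]
    refine Submodule.sum_mem _ fun k _ => ?_
    by_cases hk : k ∈ Finset.range (s + 1)
    · exact Submodule.mem_iSup_of_mem k (Submodule.mem_iSup_of_mem hk
        (mk_mem_quotPiece (hcomp_mem _ f)))
    · rw [Ideal.Quotient.eq_zero_iff_mem.2 (h.mem_of_lt (by simp at hk; omega) (hcomp_mem _ f))]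
      exact Submodule.zero_mem _
  refine ⟨?_⟩
  rw [htop]
  exact Submodule.fg_biSup _ _ fun k _ => (Module.Finite.iff_fg.1 (finite_polyPiece _)).map _

/-- The socle of an Artin Gorenstein algebra is its graded piece of top degree. -/
lemma IsArtinGorenstein.socle_eq (hAG : IsArtinGorenstein I) (h : HasSocleDegree I s) :
    socle I = quotPiece I s := by
  have hfin := h.finite
  have hle : quotPiece I s ≤ socle I := by
    rintro _ ⟨f, hf, rfl⟩
    exact mk_mem_socle_iff.2 fun i => h.mem_of_lt (by omega)
      (mul_mem_polyPiece hf (X_mem_polyPiece i))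
  refine (Submodule.eq_of_le_of_finrank_le hle ?_).symm
  rw [hAG.socle_dim, Nat.one_le_iff_ne_zero, ne_eq, Submodule.finrank_eq_zero]
  exact h.1

/-- A form outside `I` has a multiple of socle degree outside `I`. -/
lemma IsArtinGorenstein.exists_mul_notMem (hAG : IsArtinGorenstein I) (h : HasSocleDegree I s)
    (k : ℕ) : ∀ (j : ℤ), j + k = s → ∀ f ∈ polyPiece n K j, f ∉ I →
      ∃ g ∈ polyPiece n K (k : ℤ), f * g ∉ I := by
  induction k with
  | zero =>
    intro j _ f hf hfI
    exact ⟨1, isWeightedHomogeneous_one K _, by rwa [mul_one]⟩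
  | succ k ih =>
    intro j hj f hf hfI
    push_cast at hj
    have h1 : ∃ i, f * X i ∉ I := by
      by_contra! hcon
      have h2 := mk_mem_socle_iff.2 hcon
      rw [hAG.socle_eq h] at h2
      obtain ⟨g, hg, hfg⟩ := h2
      have h3 : f - g ∈ I := (Ideal.Quotient.eq).1 hfg.symm
      have h4 := hAG.hcomp_mem h3 j
      rw [map_sub, hcomp_of_mem hf, hcomp_of_mem_ne hg (by omega), sub_zero] at h4
      exact hfI h4
    obtain ⟨i, hi⟩ := h1
    obtain ⟨g, hg, hfg⟩ := ih (j + 1) (by omega) _ (mul_mem_polyPiece hf (X_mem_polyPiece i)) hi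
    refine ⟨X i * g, ?_, by rwa [← mul_assoc]⟩
    have := mul_mem_polyPiece (X_mem_polyPiece i) hg
    rwa [add_comm] at this

/-- A functional on `A = S/I` which does not vanish on the socle. -/
lemma IsArtinGorenstein.exists_functional (hAG : IsArtinGorenstein I) :
    ∃ φ : (PolyRing n K ⧸ I) →ₗ[K] K, ∀ a ∈ socle I, φ a = 0 → a = 0 := by
  obtain ⟨s, hs, hspan⟩ := finrank_eq_one_iff'.1 hAG.socle_dim
  have hs' : (s : PolyRing n K ⧸ I) ≠ 0 := fun h => hs (Subtype.ext h)
  have : ∃ φ : Module.Dual K (PolyRing n K ⧸ I), φ s ≠ 0 := by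
    by_contra! hcon
    exact hs' ((Module.forall_dual_apply_eq_zero_iff K _).1 hcon)
  obtain ⟨φ, hφ⟩ := this
  refine ⟨φ, fun a ha h0 => ?_⟩
  obtain ⟨c, hc⟩ := hspan ⟨a, ha⟩
  have hc' : a = c • (s : PolyRing n K ⧸ I) := congrArg Subtype.val hc.symm
  rw [hc', map_smul, smul_eq_mul, mul_eq_zero] at h0
  rw [hc', h0.resolve_right hφ, zero_smul]

/-- The multiplication pairing `A_j × A_{s-j} → A_s` is nondegenerate, whence the symmetry of the
Hilbert function. -/
lemma IsArtinGorenstein.hilbertFunction_symm (hAG : IsArtinGorenstein I) (h : HasSocleDegree I s)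
    {j k : ℕ} (hjk : j + k = s) : hilbertFunction I j = hilbertFunction I k := by
  have key : ∀ j k : ℕ, j + k = s → hilbertFunction I j ≤ hilbertFunction I k := by
    intro j k hjk
    have hfin := h.finite
    obtain ⟨φ, hφ⟩ := hAG.exists_functional
    let Φ : quotPiece I j →ₗ[K] Module.Dual K (quotPiece I k) :=
      ((LinearMap.mul K (PolyRing n K ⧸ I)).compr₂ φ).domRestrict₁₂ _ _
    have hΦ : Function.Injective Φ := by
      rw [← LinearMap.ker_eq_bot, eq_bot_iff]
      rintro ⟨_, f, hf, rfl⟩ h0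
      by_contra hne
      have hfI : f ∉ I := fun hfI => hne (Subtype.ext (Ideal.Quotient.eq_zero_iff_mem.2 hfI))
      obtain ⟨g, hg, hfg⟩ := hAG.exists_mul_notMem h k j (by exact_mod_cast hjk) f hf hfI
      have h1 := LinearMap.congr_fun h0 ⟨_, mk_mem_quotPiece hg⟩
      have h2 : φ (Ideal.Quotient.mk I (f * g)) = 0 := h1
      refine hfg (Ideal.Quotient.eq_zero_iff_mem.1 (hφ _ ?_ h2))
      rw [hAG.socle_eq h]
      have := mul_mem_polyPiece hf hg
      exact mk_mem_quotPiece (by rwa [← hjk, Nat.cast_add])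
    have := LinearMap.finrank_le_finrank_of_injective hΦ
    rwa [Subspace.dual_finrank_eq] at this
  exact le_antisymm (key j k hjk) (key k j (by omega))

/-- An Artin Gorenstein algebra is a Frobenius algebra: a functional which does not vanish on the
socle induces a nondegenerate bilinear form. -/
lemma IsArtinGorenstein.exists_frobenius (hAG : IsArtinGorenstein I) (h : HasSocleDegree I s) :
    ∃ φ : (PolyRing n K ⧸ I) →ₗ[K] K, ∀ a, (∀ b, φ (a * b) = 0) → a = 0 := by
  classical
  obtain ⟨φ, hφ⟩ := hAG.exists_functional
  refine ⟨φ, fun a ha => ?_⟩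
  obtain ⟨f, rfl⟩ := Ideal.Quotient.mk_surjective a
  by_contra hne
  rw [Ideal.Quotient.eq_zero_iff_mem] at hne
  have hex : ∃ k : ℕ, hcomp (k : ℤ) f ∉ I := by
    by_contra! hcon
    exact hne (sum_hcomp f ▸ Ideal.sum_mem _ fun k _ => hcon k)
  -- multiply the component of lowest degree into the socle
  set m := Nat.find hex with hm
  have hm0 : hcomp (m : ℤ) f ∉ I := Nat.find_spec hex
  have hms : m ≤ s := by
    by_contra! hlt
    exact hm0 (h.mem_of_lt (by exact_mod_cast hlt) (ArtinGor.hcomp_mem _ f))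
  obtain ⟨g, hg, hfg⟩ := hAG.exists_mul_notMem h (s - m) m (by push_cast [hms]; ring) _
    (ArtinGor.hcomp_mem _ f) hm0
  have hmk : Ideal.Quotient.mk I (f * g) = Ideal.Quotient.mk I (hcomp (m : ℤ) f * g) := by
    rw [Ideal.Quotient.eq]
    have hmem : m ∈ Finset.range (f.totalDegree + 1) := by
      by_contra hlt
      refine hm0 ?_
      rw [hcomp_natCast, homogeneousComponent_eq_zero _ _ (by simp at hlt; omega)]
      exact I.zero_mem
    have hdiff : f * g - hcomp (m : ℤ) f * g =
        ∑ k ∈ (Finset.range (f.totalDegree + 1)).erase m, hcomp (k : ℤ) f * g := by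
      rw [← Finset.sum_mul, ← sub_mul]
      congr 1
      rw [sub_eq_iff_eq_add', Finset.add_sum_erase _ (fun k : ℕ => hcomp (k : ℤ) f) hmem, sum_hcomp]
    rw [hdiff]
    refine Ideal.sum_mem _ fun k hk => ?_
    rcases lt_or_gt_of_ne (Finset.ne_of_mem_erase hk) with hlt | hlt
    · exact Ideal.mul_mem_right _ _ (not_not.1 (Nat.find_min hex hlt))
    · exact h.mem_of_lt (by omega) (mul_mem_polyPiece (ArtinGor.hcomp_mem (k : ℤ) f) hg)
  have h1 := ha (Ideal.Quotient.mk I g)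
  rw [← map_mul, hmk] at h1
  refine hfg (Ideal.Quotient.eq_zero_iff_mem.1 (hφ _ ?_ h1))
  rw [hAG.socle_eq h]
  have := mul_mem_polyPiece (ArtinGor.hcomp_mem (m : ℤ) f) hg
  rw [show (m : ℤ) + ((s - m : ℕ) : ℤ) = s by omega] at this
  exact mk_mem_quotPiece this

end Gorenstein

section Duality

variable {R A : Type*} [CommRing R] [Algebra K R] [CommRing A] [Algebra K A] [Algebra R A]
  [IsScalarTower K R A]
  {ι κ μ : Type*} [Fintype κ] [Fintype μ]

/-- The dimension over `K` of the image of a matrix acting on powers of `A`. -/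
def matRank (K : Type*) [Field K] {R : Type*} [CommRing R] [Algebra K R] {ι κ : Type*} [Fintype κ]
    (D : Matrix ι κ R) (A : Type*) [CommRing A] [Algebra K A] [Algebra R A]
    [IsScalarTower K R A] : ℕ :=
  Module.finrank K (LinearMap.range ((matAct D A).restrictScalars K))

lemma finrank_matHomology [Module.Finite K A] {E : Matrix κ μ R} {D : Matrix ι κ R}
    (hDE : D * E = 0) :
    Module.finrank K (matHomology E D A) + matRank K E A + matRank K D A =
      Fintype.card κ * Module.finrank K A := by
  let E' : (μ → A) →ₗ[K] LinearMap.ker (matAct D A) :=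
    ((matAct E A).codRestrict (LinearMap.ker (matAct D A)) (fun v => by
      rw [LinearMap.mem_ker, matAct_matAct, hDE, matAct_zero])).restrictScalars K
  let q : LinearMap.ker (matAct D A) →ₗ[K] matHomology E D A :=
    (Submodule.mkQ ((LinearMap.range (matAct E A)).comap
      (LinearMap.ker (matAct D A)).subtype)).restrictScalars K
  have hq : Function.Surjective q := fun x => by
    obtain ⟨y, rfl⟩ := Submodule.Quotient.mk_surjective _ x
    exact ⟨y, rfl⟩
  have hqE : LinearMap.ker q = LinearMap.range E' := by
    ext v
    rw [LinearMap.mem_ker, LinearMap.mem_range]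
    refine Iff.trans (b := v ∈ (LinearMap.range (matAct E A)).comap
      (LinearMap.ker (matAct D A)).subtype) (Submodule.Quotient.mk_eq_zero _) ?_
    constructor
    · rintro ⟨w, hw⟩
      exact ⟨w, Subtype.ext hw⟩
    · rintro ⟨w, rfl⟩
      exact ⟨w, rfl⟩
  have : Module.Finite K (LinearMap.ker (matAct D A)) :=
    inferInstanceAs (Module.Finite K ((LinearMap.ker (matAct D A)).restrictScalars K))
  have h1 := q.finrank_range_add_finrank_ker
  rw [LinearMap.range_eq_top.2 hq, finrank_top, hqE] at h1
  have h2 := ((matAct D A).restrictScalars K).finrank_range_add_finrank_ker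
  have h3 := ((matAct E A).restrictScalars K).finrank_range_add_finrank_ker
  have h4 := E'.finrank_range_add_finrank_ker
  have h5 : LinearMap.ker E' = LinearMap.ker ((matAct E A).restrictScalars K) := by
    ext v
    rw [LinearMap.mem_ker, LinearMap.mem_ker, Subtype.ext_iff]
    rfl
  rw [h5] at h4
  have h6 : Module.finrank K (LinearMap.ker ((matAct D A).restrictScalars K)) =
    Module.finrank K (LinearMap.ker (matAct D A)) := rfl
  have h7 : Module.finrank K (κ → A) = Fintype.card κ * Module.finrank K A := by
    rw [Module.finrank_pi_fintype, Finset.sum_const, Finset.card_univ, smul_eq_mul]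
  rw [← h7]
  unfold matRank
  omega

lemma matRank_submatrix {ο : Type*} [Fintype ο] (D : Matrix ι κ R) (σ : ο ≃ ι) :
    matRank K (D.submatrix σ id) A = matRank K D A := by
  have : (matAct (D.submatrix σ id) A).restrictScalars K =
      (LinearEquiv.funCongrLeft K A σ).toLinearMap.comp ((matAct D A).restrictScalars K) := rfl
  rw [matRank, this, LinearMap.range_comp]
  exact LinearEquiv.finrank_map_eq _ _

/-- The perfect pairing `(u, v) ↦ ∑ φ (u i * v i)` on `A^τ` induced by a functional `φ` with
nondegenerate form `φ (a * b)`. -/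
lemma exists_equiv_dual [Module.Finite K A] {φ : A →ₗ[K] K}
    (hφ : ∀ a, (∀ b, φ (a * b) = 0) → a = 0) (τ : Type*) [Fintype τ] :
    ∃ e : (τ → A) ≃ₗ[K] Module.Dual K (τ → A), ∀ u v, e u v = ∑ i, φ (u i * v i) := by
  classical
  let B : (τ → A) →ₗ[K] Module.Dual K (τ → A) :=
    ∑ i, ((LinearMap.mul K A).compr₂ φ).compl₁₂ (LinearMap.proj i) (LinearMap.proj i)
  have hB : ∀ u v, B u v = ∑ i, φ (u i * v i) := fun u v => by
    simp [B, LinearMap.sum_apply]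
  have hinj : Function.Injective B := by
    rw [← LinearMap.ker_eq_bot, eq_bot_iff]
    intro u hu
    rw [LinearMap.mem_ker] at hu
    rw [Submodule.mem_bot]
    ext i
    refine hφ _ fun b => ?_
    have := LinearMap.congr_fun hu (Pi.single i b)
    rw [hB, Finset.sum_eq_single i] at this
    · simpa using this
    · intro k _ hk
      simp [hk]
    · simp
  exact ⟨LinearEquiv.ofInjectiveOfFinrankEq B hinj (Subspace.dual_finrank_eq).symm, hB⟩

/-- Over a Frobenius algebra a matrix and its transpose have the same rank over `K`, since the
pairings of `exists_equiv_dual` make them adjoint to each other. -/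
lemma matRank_transpose [Module.Finite K A] [Fintype ι] {φ : A →ₗ[K] K}
    (hφ : ∀ a, (∀ b, φ (a * b) = 0) → a = 0) (D : Matrix ι κ R) :
    matRank K D.transpose A = matRank K D A := by
  obtain ⟨e, he⟩ := exists_equiv_dual hφ κ
  obtain ⟨e', he'⟩ := exists_equiv_dual hφ ι
  have hadj : e.toLinearMap.comp ((matAct D.transpose A).restrictScalars K) =
      ((matAct D A).restrictScalars K).dualMap.comp e'.toLinearMap := by
    ext1 w
    refine LinearMap.ext fun u => ?_
    change e (matAct D.transpose A w) u = e' w (matAct D A u)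
    rw [he, he']
    simp only [matAct_apply, Finset.sum_mul, Finset.mul_sum, map_sum, Matrix.transpose_apply]
    rw [Finset.sum_comm]
    refine Finset.sum_congr rfl fun i _ => Finset.sum_congr rfl fun j _ => ?_
    rw [smul_mul_assoc, mul_smul_comm]
  have h1 := congrArg LinearMap.range hadj
  rw [LinearMap.range_comp, LinearMap.range_comp] at h1
  replace h1 : Module.finrank K (Submodule.map e.toLinearMap _) = Module.finrank K _ :=
    congrArg (fun p : Submodule K (Module.Dual K (κ → A)) => Module.finrank K p) h1
  rw [LinearEquiv.finrank_map_eq, LinearEquiv.range, Submodule.map_top,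
    LinearMap.finrank_range_dualMap_eq_finrank_range] at h1
  exact h1

end Duality

/-- Self-duality of the Koszul homology of an Artin Gorenstein algebra: up to signs and order of the
rows, `koszul4` and `koszul3` are the transposes of `koszul1` and `koszul2`. -/
lemma IsArtinGorenstein.finrank_koszulH3 {I : Ideal (PolyRing 4 K)} (hAG : IsArtinGorenstein I)
    {s : ℕ} (h : HasSocleDegree I s) :
    Module.finrank K (KoszulH3 K (PolyRing 4 K ⧸ I)) =
      Module.finrank K (KoszulH1 K (PolyRing 4 K ⧸ I)) := by
  have hfin := h.finite
  obtain ⟨φ, hφ⟩ := hAG.exists_frobenius h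
  have h3 := finrank_matHomology (K := K) (A := PolyRing 4 K ⧸ I)
    (koszul3_mul_koszul4 (X : Fin 4 → PolyRing 4 K))
  have h1 := finrank_matHomology (K := K) (A := PolyRing 4 K ⧸ I)
    (koszul1_mul_koszul2 (X : Fin 4 → PolyRing 4 K))
  have h4 := matRank_transpose hφ (koszul1 (X : Fin 4 → PolyRing 4 K))
  rw [koszul4_transpose] at h4
  have h2 := matRank_transpose hφ (koszul2 (X : Fin 4 → PolyRing 4 K))
  have hσ : Function.Bijective (![3, 4, 5, 0, 1, 2] : Fin 6 → Fin 6) := by decide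
  have h2' := matRank_submatrix (K := K) (A := PolyRing 4 K ⧸ I)
    (koszul2 (X : Fin 4 → PolyRing 4 K)).transpose (Equiv.ofBijective _ hσ)
  rw [Equiv.coe_ofBijective, koszul3_submatrix] at h2'
  unfold KoszulH3 KoszulH1
  omega

end

/-! ### Regular sequences of quadrics -/

section

variable {K : Type*} [Field K]

/-- Vanishing of homology passes to the cokernel in a short exact sequence `0 → N → F → M → 0`,
with a shift on the side of `N`. -/
lemma exists_matAct_of_exact {R : Type*} [CommRing R] {ι κ μ ο : Type*} [Fintype ι] [Fintype κ]
    [Fintype μ] {M N F : Type*} [AddCommGroup M] [Module R M] [AddCommGroup N] [Module R N]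
    [AddCommGroup F] [Module R F]
    {E : Matrix κ μ R} {D : Matrix ι κ R} {D' : Matrix ο ι R} (hD : D' * D = 0)
    {i : N →ₗ[R] F} {g : F →ₗ[R] M} (hi : Function.Injective i) (hg : Function.Surjective g)
    (hex : Function.Exact i g) (h1 : ∀ v, matAct D F v = 0 → ∃ w, matAct E F w = v)
    (h2 : ∀ v, matAct D' N v = 0 → ∃ w, matAct D N w = v) (v : κ → M) (hv : matAct D M v = 0) :
    ∃ w, matAct E M w = v := by
  obtain ⟨f, rfl⟩ := exists_comp_eq hg v
  rw [← comp_matAct] at hv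
  obtain ⟨u, hu⟩ := exists_comp_eq_of_exact hex _ (congrFun hv)
  obtain ⟨y, rfl⟩ := h2 u (by
    ext k
    apply hi
    refine (congrFun (comp_matAct i D' u) k).trans ?_
    rw [hu]
    refine (congrFun (matAct_matAct D' D f) k).trans ?_
    rw [hD, matAct_zero]
    simp)
  obtain ⟨w, hw⟩ := h1 (f - fun k => i (y k)) (by
    rw [map_sub, ← comp_matAct, hu]
    exact sub_self _)
  refine ⟨fun k => g (w k), ?_⟩
  rw [← comp_matAct, hw]
  ext k
  simp [(hex _).2 ⟨y k, rfl⟩]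

section NextQuotient

variable {n : ℕ} {J : Ideal (PolyRing n K)} {q : PolyRing n K}

lemma mulLeft_quotient_apply (f : PolyRing n K) :
    LinearMap.lsmul (PolyRing n K) (PolyRing n K ⧸ J) q (Ideal.Quotient.mk J f) =
      Ideal.Quotient.mk J (q * f) := rfl

lemma mul_injective_of_regular (hq : ∀ f, q * f ∈ J → f ∈ J) :
    Function.Injective (LinearMap.lsmul (PolyRing n K) (PolyRing n K ⧸ J) q) := by
  rw [← LinearMap.ker_eq_bot, eq_bot_iff]
  intro a ha
  obtain ⟨f, rfl⟩ := Ideal.Quotient.mk_surjective a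
  rw [LinearMap.mem_ker, mulLeft_quotient_apply, Ideal.Quotient.eq_zero_iff_mem] at ha
  exact Ideal.Quotient.eq_zero_iff_mem.2 (hq f ha)

/-- The projection `S/J → S/(J, q)`. -/
def factorSup (J : Ideal (PolyRing n K)) (q : PolyRing n K) :
    (PolyRing n K ⧸ J) →ₗ[PolyRing n K] (PolyRing n K ⧸ (J ⊔ Ideal.span {q})) :=
  Submodule.factor le_sup_left

lemma factorSup_mk (f : PolyRing n K) :
    factorSup J q (Ideal.Quotient.mk J f) = Ideal.Quotient.mk (J ⊔ Ideal.span {q}) f := rfl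

lemma factorSup_surjective : Function.Surjective (factorSup J q) := fun a => by
  obtain ⟨f, rfl⟩ := Ideal.Quotient.mk_surjective a
  exact ⟨Ideal.Quotient.mk J f, rfl⟩

lemma exact_mul_factorSup :
    Function.Exact (LinearMap.lsmul (PolyRing n K) (PolyRing n K ⧸ J) q) (factorSup J q) := by
  intro a
  obtain ⟨f, rfl⟩ := Ideal.Quotient.mk_surjective a
  rw [factorSup_mk, Ideal.Quotient.eq_zero_iff_mem, Submodule.mem_sup]
  constructor
  · rintro ⟨y, hy, z, hz, rfl⟩
    obtain ⟨c, rfl⟩ := Ideal.mem_span_singleton'.1 hz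
    refine ⟨Ideal.Quotient.mk J c, ?_⟩
    rw [mulLeft_quotient_apply, mul_comm, map_add, Ideal.Quotient.eq_zero_iff_mem.2 hy, zero_add]
  · rintro ⟨b, hb⟩
    obtain ⟨c, rfl⟩ := Ideal.Quotient.mk_surjective b
    rw [mulLeft_quotient_apply] at hb
    have := Ideal.Quotient.eq.1 hb.symm
    exact ⟨_, this, q * c, Ideal.mem_span_singleton'.2 ⟨c, mul_comm _ _⟩, by ring⟩

lemma hcomp_mem_sup {e : ℤ} (hq : q ∈ polyPiece n K e) (hJ : ∀ f ∈ J, ∀ j : ℤ, hcomp j f ∈ J) :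
    ∀ f ∈ J ⊔ Ideal.span {q}, ∀ j : ℤ, hcomp j f ∈ J ⊔ Ideal.span {q} := by
  intro f hf j
  obtain ⟨y, hy, z, hz, rfl⟩ := Submodule.mem_sup.1 hf
  obtain ⟨c, rfl⟩ := Ideal.mem_span_singleton'.1 hz
  rw [map_add, hcomp_mul_right _ _ hq]
  exact Submodule.add_mem_sup (hJ y hy j) (Ideal.mem_span_singleton'.2 ⟨_, rfl⟩)

instance finite_quotPiece (j : ℤ) : Module.Finite K (quotPiece J j) :=
  Module.Finite.map _ _

/-- The Hilbert function of the quotient by a regular form. -/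
lemma hilbertFunction_sup {e : ℤ} (hqe : q ∈ polyPiece n K e)
    (hJ : ∀ f ∈ J, ∀ j : ℤ, hcomp j f ∈ J) (hq : ∀ f, q * f ∈ J → f ∈ J) (j : ℤ) :
    hilbertFunction (J ⊔ Ideal.span {q}) j + hilbertFunction J (j - e) = hilbertFunction J j := by
  let a : quotPiece J (j - e) →ₗ[K] quotPiece J j :=
    ((LinearMap.lsmul (PolyRing n K) (PolyRing n K ⧸ J) q).restrictScalars K).restrict (by
      rintro _ ⟨f, hf, rfl⟩
      have := mul_mem_polyPiece hqe hf
      rw [add_sub_cancel] at this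
      exact mk_mem_quotPiece this)
  let b : quotPiece J j →ₗ[K] quotPiece (J ⊔ Ideal.span {q}) j :=
    ((factorSup J q).restrictScalars K).restrict (by
      rintro _ ⟨f, hf, rfl⟩
      exact mk_mem_quotPiece hf)
  have ha : Function.Injective a := fun x y h =>
    Subtype.ext (mul_injective_of_regular hq (congrArg Subtype.val h))
  have hb : Function.Surjective b := by
    rintro ⟨_, f, hf, rfl⟩
    exact ⟨⟨_, mk_mem_quotPiece hf⟩, rfl⟩
  have hab : LinearMap.ker b = LinearMap.range a := by
    ext x
    obtain ⟨_, f, hf, rfl⟩ := x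
    rw [LinearMap.mem_ker, LinearMap.mem_range, Subtype.ext_iff]
    constructor
    · intro h
      have h' : f ∈ J ⊔ Ideal.span {q} := Ideal.Quotient.eq_zero_iff_mem.1 h
      obtain ⟨y, hy, z, hz, hyz⟩ := Submodule.mem_sup.1 h'
      obtain ⟨c, rfl⟩ := Ideal.mem_span_singleton'.1 hz
      have h1 : f = hcomp j y + hcomp (j - e) c * q := by
        rw [← hcomp_mul_right _ _ hqe, ← map_add, hyz, hcomp_of_mem hf]
      refine ⟨⟨_, mk_mem_quotPiece (hcomp_mem (j - e) c)⟩, Subtype.ext ?_⟩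
      change Ideal.Quotient.mk J (q * hcomp (j - e) c) = Ideal.Quotient.mk J f
      rw [h1, map_add, Ideal.Quotient.eq_zero_iff_mem.2 (hJ y hy j), zero_add, mul_comm]
    · rintro ⟨y, hy⟩
      exact (exact_mul_factorSup _).2 ⟨y.1, congrArg Subtype.val hy⟩
  have h1 := b.finrank_range_add_finrank_ker
  rw [LinearMap.range_eq_top.2 hb, finrank_top, hab, LinearMap.finrank_range_of_inj ha] at h1
  exact h1

end NextQuotient

lemma hilbertFunction_bot (n : ℕ) (j : ℤ) :
    hilbertFunction (⊥ : Ideal (PolyRing n K)) j = Module.finrank K (polyPiece n K j) := by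
  refine (LinearEquiv.finrank_eq (Submodule.equivMapOfInjective _ ?_ _)).symm
  intro f g h
  have := (Ideal.Quotient.eq).1 h
  exact sub_eq_zero.1 ((Submodule.mem_bot _).1 this)

lemma finrank_polyPiece_four (m : ℕ) :
    Module.finrank K (polyPiece 4 K (m : ℤ)) = (m + 3).choose 3 := by
  rw [finrank_polyPiece_natCast, Nat.multichoose_eq, Nat.choose_symm_of_eq_add]
  · congr 1; omega
  · omega

/-- Prime avoidance over an infinite field: if `S/J` has no socle, and some power of every variable
lies in `I`, where `I` is generated by forms of a degree `d ≤ 2`, then some quadric in `I` is a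
nonzerodivisor on `S/J`. -/
lemma exists_regular_quadric [Infinite K] {I J : Ideal (PolyRing 4 K)} {d : ℕ} (hd : d ≤ 2)
    {G : Set (PolyRing 4 K)} (hG : ∀ g ∈ G, g.IsHomogeneous d) (hGI : Ideal.span G = I)
    {N : ℕ} (hN : ∀ i, (X i : PolyRing 4 K) ^ N ∈ I)
    (hJ : ∀ f : PolyRing 4 K, (∀ i, f * X i ∈ J) → f ∈ J) :
    ∃ q ∈ I, q ∈ polyPiece 4 K 2 ∧ ∀ f, q * f ∈ J → f ∈ J := by
  let V : Submodule K (PolyRing 4 K) := I.restrictScalars K ⊓ polyPiece 4 K 2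
  have hfin : Finite (associatedPrimes (PolyRing 4 K) (PolyRing 4 K ⧸ J)) :=
    (associatedPrimes.finite _ _).to_subtype
  let W : associatedPrimes (PolyRing 4 K) (PolyRing 4 K ⧸ J) → Submodule K V := fun P =>
    ((P : Ideal (PolyRing 4 K)).restrictScalars K).comap V.subtype
  have hW : ∀ P, W P ≠ ⊤ := by
    rintro ⟨P, hP⟩ htop
    have hprime := hP.1
    have hVP : ∀ q ∈ V, q ∈ P := fun q hq => by
      have : (⟨q, hq⟩ : V) ∈ W ⟨P, hP⟩ := htop ▸ Submodule.mem_top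
      exact this
    obtain ⟨a, ha⟩ := (isAssociatedPrime_iff.1 hP).2
    obtain ⟨f, rfl⟩ := Ideal.Quotient.mk_surjective a
    have hmem : ∀ r, r ∈ P ↔ f * r ∈ J := fun r => by
      rw [ha, Submodule.mem_colon_singleton, Submodule.mem_bot, mul_comm]
      exact Ideal.Quotient.eq_zero_iff_mem
    have hX : ∃ i, (X i : PolyRing 4 K) ∉ P := by
      by_contra! hcon
      refine hprime.ne_top ((Ideal.eq_top_iff_one P).2 ((hmem 1).2 ?_))
      rw [mul_one]
      exact hJ f fun i => (hmem _).1 (hcon i)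
    obtain ⟨i, hi⟩ := hX
    have hIP : I ≤ P := by
      rw [← hGI, Ideal.span_le]
      intro g hg
      have h1 : X i ^ (2 - d) * g ∈ V := by
        refine ⟨I.mul_mem_left _ (hGI ▸ Ideal.subset_span hg), ?_⟩
        have h2 := ((isHomogeneous_X K i).pow (2 - d)).mul (hG g hg)
        rw [one_mul, Nat.sub_add_cancel hd] at h2
        exact isHomogeneous_iff_mem_polyPiece.1 h2
      exact (hprime.mem_or_mem (hVP _ h1)).resolve_left
        fun h => hi (hprime.mem_of_pow_mem _ h)
    exact hi (hprime.mem_of_pow_mem _ (hIP (hN i)))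
  have hcov : (⋃ P, (W P : Set V)) ≠ Set.univ := fun h => by
    obtain ⟨P, hP⟩ := Subspace.exists_eq_top_of_iUnion_eq_univ h
    exact hW P hP
  obtain ⟨q, hq⟩ := (Set.ne_univ_iff_exists_notMem _).1 hcov
  have hreg : IsSMulRegular (PolyRing 4 K ⧸ J) (q : PolyRing 4 K) := by
    by_contra hn
    have h1 : (q : PolyRing 4 K) ∈
        ⋃ p ∈ associatedPrimes (PolyRing 4 K) (PolyRing 4 K ⧸ J), (p : Set (PolyRing 4 K)) := by
      rw [biUnion_associatedPrimes_eq_compl_regular]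
      exact hn
    simp only [Set.mem_iUnion] at h1 hq
    obtain ⟨P, hP, hqP⟩ := h1
    exact hq ⟨⟨P, hP⟩, hqP⟩
  refine ⟨q, q.2.1, q.2.2, fun f hf => ?_⟩
  rw [← Ideal.Quotient.eq_zero_iff_mem] at hf ⊢
  exact hreg.right_eq_zero_of_smul hf

lemma exists_matAct_bot {ι κ μ : Type*} [Fintype ι] [Fintype κ] [Fintype μ]
    {E : Matrix κ μ (PolyRing 4 K)} {D : Matrix ι κ (PolyRing 4 K)}
    (h : ∀ v, matAct D (PolyRing 4 K) v = 0 → ∃ w, matAct E (PolyRing 4 K) w = v) :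
    ∀ v, matAct D (PolyRing 4 K ⧸ (⊥ : Ideal (PolyRing 4 K))) v = 0 →
      ∃ w, matAct E (PolyRing 4 K ⧸ (⊥ : Ideal (PolyRing 4 K))) w = v :=
  exists_matAct_of_exact (D' := (0 : Matrix (Fin 0) ι (PolyRing 4 K))) (Matrix.zero_mul _)
    (i := Submodule.subtype (⊥ : Ideal (PolyRing 4 K))) (g := Submodule.mkQ _)
    (Submodule.subtype_injective _) (Submodule.mkQ_surjective _) (LinearMap.exact_subtype_mkQ _) h
    fun v _ => ⟨0, by ext1 k; exact Subsingleton.elim _ _⟩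

lemma exists_matAct_sup {ι κ μ ο : Type*} [Fintype ι] [Fintype κ] [Fintype μ]
    {E : Matrix κ μ (PolyRing 4 K)} {D : Matrix ι κ (PolyRing 4 K)}
    {D' : Matrix ο ι (PolyRing 4 K)} (hD : D' * D = 0) {J : Ideal (PolyRing 4 K)}
    {q : PolyRing 4 K} (hq : ∀ f, q * f ∈ J → f ∈ J)
    (h1 : ∀ v, matAct D (PolyRing 4 K ⧸ J) v = 0 → ∃ w, matAct E (PolyRing 4 K ⧸ J) w = v)
    (h2 : ∀ v, matAct D' (PolyRing 4 K ⧸ J) v = 0 → ∃ w, matAct D (PolyRing 4 K ⧸ J) w = v) :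
    ∀ v, matAct D (PolyRing 4 K ⧸ (J ⊔ Ideal.span {q})) v = 0 →
      ∃ w, matAct E (PolyRing 4 K ⧸ (J ⊔ Ideal.span {q})) w = v :=
  exists_matAct_of_exact hD (mul_injective_of_regular hq) factorSup_surjective exact_mul_factorSup
    h1 h2

lemma mem_of_koszul4_exact {J : Ideal (PolyRing 4 K)}
    (h : ∀ v, matAct (koszul4 (X : Fin 4 → PolyRing 4 K)) (PolyRing 4 K ⧸ J) v = 0 →
      ∃ w, matAct (0 : Matrix (Fin 1) (Fin 0) (PolyRing 4 K)) (PolyRing 4 K ⧸ J) w = v)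
    (f : PolyRing 4 K) (hf : ∀ i, f * X i ∈ J) : f ∈ J := by
  have hX : ∀ i, (X i : PolyRing 4 K) • Ideal.Quotient.mk J f = 0 := fun i => by
    have : X i * f ∈ J := mul_comm f (X i) ▸ hf i
    exact Ideal.Quotient.eq_zero_iff_mem.2 this
  obtain ⟨w, hw⟩ := h (fun _ => Ideal.Quotient.mk J f) (by
    ext k
    fin_cases k <;> simp [matAct_apply, koszul4, hX])
  rw [matAct_zero] at hw
  exact Ideal.Quotient.eq_zero_iff_mem.1 (congrFun hw 0).symm

/-- An ideal generated by forms of a degree `d ≤ 2` that contains a power of every variable contains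
all forms of degree `5`: it contains a regular sequence of four quadrics, and the Hilbert function
of the complete intersection of these is `(1, 4, 6, 4, 1)`. -/
lemma mem_of_generated_degree_le_two [Infinite K] {I : Ideal (PolyRing 4 K)} {d : ℕ} (hd : d ≤ 2)
    {G : Set (PolyRing 4 K)} (hG : ∀ g ∈ G, g.IsHomogeneous d) (hGI : Ideal.span G = I)
    {N : ℕ} (hN : ∀ i, (X i : PolyRing 4 K) ^ N ∈ I) :
    ∀ f ∈ polyPiece 4 K 5, f ∈ I := by
  have hreg := isRegularQuadruple_X (K := K)
  have h01 := exists_matAct_bot hreg.exact₁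
  have h02 := exists_matAct_bot hreg.exact₂
  have h03 := exists_matAct_bot hreg.exact₃
  have h04 := exists_matAct_bot exists_matAct_zero_of_koszul4 (K := K)
  have hh0 : ∀ f ∈ (⊥ : Ideal (PolyRing 4 K)), ∀ j : ℤ, hcomp j f ∈ (⊥ : Ideal (PolyRing 4 K)) :=
    fun f hf j => by rw [(Submodule.mem_bot _).1 hf, map_zero]; exact Submodule.zero_mem _
  obtain ⟨q₁, hI₁, hq₁, hr₁⟩ := exists_regular_quadric hd hG hGI hN (mem_of_koszul4_exact h04)
  have h12 := exists_matAct_sup (koszul1_mul_koszul2 _) hr₁ h02 h01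
  have h13 := exists_matAct_sup (koszul2_mul_koszul3 _) hr₁ h03 h02
  have h14 := exists_matAct_sup (koszul3_mul_koszul4 _) hr₁ h04 h03
  have hh1 := hcomp_mem_sup hq₁ hh0
  have hf1 := hilbertFunction_sup hq₁ hh0 hr₁
  have hJ₁ := sup_le (bot_le (a := I)) ((Ideal.span_singleton_le_iff_mem I).2 hI₁)
  generalize ⊥ ⊔ Ideal.span {q₁} = J₁ at *
  obtain ⟨q₂, hI₂, hq₂, hr₂⟩ := exists_regular_quadric hd hG hGI hN (mem_of_koszul4_exact h14)
  have h23 := exists_matAct_sup (koszul2_mul_koszul3 _) hr₂ h13 h12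
  have h24 := exists_matAct_sup (koszul3_mul_koszul4 _) hr₂ h14 h13
  have hh2 := hcomp_mem_sup hq₂ hh1
  have hf2 := hilbertFunction_sup hq₂ hh1 hr₂
  have hJ₂ := sup_le hJ₁ ((Ideal.span_singleton_le_iff_mem I).2 hI₂)
  generalize J₁ ⊔ Ideal.span {q₂} = J₂ at *
  obtain ⟨q₃, hI₃, hq₃, hr₃⟩ := exists_regular_quadric hd hG hGI hN (mem_of_koszul4_exact h24)
  have h34 := exists_matAct_sup (koszul3_mul_koszul4 _) hr₃ h24 h23
  have hh3 := hcomp_mem_sup hq₃ hh2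
  have hf3 := hilbertFunction_sup hq₃ hh2 hr₃
  have hJ₃ := sup_le hJ₂ ((Ideal.span_singleton_le_iff_mem I).2 hI₃)
  generalize J₂ ⊔ Ideal.span {q₃} = J₃ at *
  obtain ⟨q₄, hI₄, hq₄, hr₄⟩ := exists_regular_quadric hd hG hGI hN (mem_of_koszul4_exact h34)
  have hf4 := hilbertFunction_sup hq₄ hh3 hr₄ 5
  have hJ₄ := sup_le hJ₃ ((Ideal.span_singleton_le_iff_mem I).2 hI₄)
  generalize J₃ ⊔ Ideal.span {q₄} = J₄ at *
  have s5 : hilbertFunction (⊥ : Ideal (PolyRing 4 K)) 5 = 56 := by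
    rw [hilbertFunction_bot]; exact finrank_polyPiece_four 5
  have s3 : hilbertFunction (⊥ : Ideal (PolyRing 4 K)) 3 = 20 := by
    rw [hilbertFunction_bot]; exact finrank_polyPiece_four 3
  have s1 : hilbertFunction (⊥ : Ideal (PolyRing 4 K)) 1 = 4 := by
    rw [hilbertFunction_bot]; exact finrank_polyPiece_four 1
  have sneg : ∀ j < 0, hilbertFunction (⊥ : Ideal (PolyRing 4 K)) j = 0 := fun j hj => by
    rw [hilbertFunction_bot, polyPiece_neg hj, finrank_bot]
  have e1 := hf1 5
  have e2 := hf1 3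
  have e3 := hf1 1
  have e4 := hf1 (-1)
  have e5 := hf2 5
  have e6 := hf2 3
  have e7 := hf2 1
  have e8 := hf3 5
  have e9 := hf3 3
  norm_num at e1 e2 e3 e4 e5 e6 e7 e8 e9 hf4
  have t1 := sneg (-1) (by norm_num)
  have t3 := sneg (-3) (by norm_num)
  have h0 : hilbertFunction J₄ 5 = 0 := by omega
  have hbot : quotPiece J₄ 5 = ⊥ := Submodule.finrank_eq_zero.1 h0
  exact fun f hf => hJ₄ (quotPiece_eq_bot_iff.1 hbot f hf)

end

/-! ### Generators and the Hilbert function -/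

section

variable {K : Type*} [Field K]

section Generators

variable {n : ℕ} {I : Ideal (PolyRing n K)}

/-- The degree `j` piece of an ideal. -/
def idealPiece (I : Ideal (PolyRing n K)) (j : ℤ) : Submodule K (PolyRing n K) :=
  I.restrictScalars K ⊓ polyPiece n K j

instance finite_idealPiece (j : ℤ) : Module.Finite K (idealPiece I j) :=
  Submodule.finiteDimensional_of_le inf_le_right

lemma hilbertFunction_add_finrank_idealPiece (I : Ideal (PolyRing n K)) (j : ℤ) :
    hilbertFunction I j + Module.finrank K (idealPiece I j) =
      Module.finrank K (polyPiece n K j) := by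
  have h1 := ((Ideal.Quotient.mkₐ K I).toLinearMap.domRestrict
    (polyPiece n K j)).finrank_range_add_finrank_ker
  rw [LinearMap.range_domRestrict] at h1
  rw [← h1]
  congr 1
  have e : LinearMap.ker ((Ideal.Quotient.mkₐ K I).toLinearMap.domRestrict (polyPiece n K j)) =
      (idealPiece I j).comap (polyPiece n K j).subtype := by
    ext f
    rw [LinearMap.mem_ker]
    constructor
    · intro h
      exact ⟨Ideal.Quotient.eq_zero_iff_mem.1 h, f.2⟩
    · intro h
      exact Ideal.Quotient.eq_zero_iff_mem.2 h.1
  rw [e]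
  exact (Submodule.comapSubtypeEquivOfLe inf_le_right).finrank_eq.symm

lemma idealPiece_eq_bot {d : ℕ} {G : Set (PolyRing n K)} (hG : ∀ g ∈ G, g.IsHomogeneous d)
    (hGI : Ideal.span G = I) {j : ℤ} (hj : j < d) : idealPiece I j = ⊥ := by
  have hle : I ≤ idealOfVars (Fin n) K ^ d := by
    rw [← hGI, Ideal.span_le]
    intro g hg
    refine (mem_pow_idealOfVars_iff d g).2 fun x hx => ?_
    have := mem_polyPiece.1 (isHomogeneous_iff_mem_polyPiece.1 (hG g hg)) x (mem_support_iff.1 hx)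
    omega
  rw [eq_bot_iff]
  rintro f ⟨hf, hfj⟩
  rw [Submodule.mem_bot]
  ext x
  by_contra hx
  have h1 := mem_polyPiece.1 hfj x hx
  exact hx ((mem_pow_idealOfVars_iff' d f).1 (hle hf) x (by omega))

end Generators

/-- If `I` is generated by forms of degree `d`, then `dim I/mI = dim I_d`: a `K`-basis of `I_d` is a
minimal system of generators. -/
lemma finrank_koszulH0_ideal {I : Ideal (PolyRing 4 K)} {d : ℕ} {G : Set (PolyRing 4 K)}
    (hG : ∀ g ∈ G, g.IsHomogeneous d) (hGI : Ideal.span G = I) :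
    Module.finrank K (KoszulH0 K I) = Module.finrank K (idealPiece I d) := by
  set r := Module.finrank K (idealPiece I d) with hr
  let b : Module.Basis (Fin r) K (idealPiece I d) := Module.finBasisOfFinrankEq K _ hr.symm
  let g : (Fin r → PolyRing 4 K) →ₗ[PolyRing 4 K] I :=
    Fintype.linearCombination (PolyRing 4 K) (fun k => (⟨(b k : PolyRing 4 K), (b k).2.1⟩ : I))
  have hg : ∀ v, (g v : PolyRing 4 K) = ∑ k, v k * (b k : PolyRing 4 K) := fun v => by
    simp [g, Fintype.linearCombination_apply]
  refine finrank_koszulH0 (g := g) ?_ ?_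
  · have hle : I ≤ (LinearMap.range g).map (Submodule.subtype I) := by
      conv_lhs => rw [← hGI]
      rw [Ideal.span_le]
      intro f hf
      have hfV : f ∈ idealPiece I d :=
        ⟨hGI ▸ Ideal.subset_span hf, isHomogeneous_iff_mem_polyPiece.1 (hG f hf)⟩
      refine ⟨g fun k => C (b.repr ⟨f, hfV⟩ k), ⟨_, rfl⟩, ?_⟩
      have h1 := congrArg Subtype.val (b.sum_repr ⟨f, hfV⟩)
      rw [Submodule.subtype_apply, hg]
      rw [Submodule.coe_sum] at h1
      simpa only [Submodule.coe_smul, smul_eq_C_mul] using h1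
    intro x
    obtain ⟨_, ⟨v, rfl⟩, hv⟩ := hle x.2
    exact ⟨v, Subtype.ext hv⟩
  · intro v hv p
    have h1 : ∑ k, v k * (b k : PolyRing 4 K) = 0 := by rw [← hg, hv]; rfl
    have h2 := congrArg (hcomp (d : ℤ)) h1
    rw [map_sum, map_zero] at h2
    have h3 : ∑ k, constantCoeff (hcomp 0 (v k)) • b k = 0 := by
      apply Subtype.ext
      rw [Submodule.coe_sum, Submodule.coe_zero, ← h2]
      refine Finset.sum_congr rfl fun k _ => ?_
      rw [hcomp_mul_right _ _ (b k).2.2, sub_self, Submodule.coe_smul, smul_eq_C_mul,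
        ← mem_polyPiece_zero (hcomp_mem 0 (v k))]
    have h4 := Fintype.linearIndependent_iff.1 b.linearIndependent _ h3 p
    rw [mem_maxIdeal, ← h4, constantCoeff_hcomp_zero]

section SocleDegreeFive

variable {I : Ideal (PolyRing 4 K)}

/-- Equigenerated Artin Gorenstein ideals of socle degree `5` in four variables are generated by
cubics: `d ≤ 2` would force `A₅ = 0`, and `d ≥ 4` is impossible since `dim S₂ ≠ dim S₃`. -/
lemma IsArtinGorenstein.degree_eq_three [CharZero K] (hAG : IsArtinGorenstein I)
    (hsoc : HasSocleDegree I (5 : ℕ)) {d : ℕ} {G : Set (PolyRing 4 K)}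
    (hG : ∀ g ∈ G, g.IsHomogeneous d) (hGI : Ideal.span G = I) : d = 3 := by
  rcases lt_trichotomy d 3 with hd | hd | hd
  · exfalso
    obtain ⟨f, hf, hfI⟩ := hsoc.exists_notMem
    refine hfI (mem_of_generated_degree_le_two (N := 6) (by omega) hG hGI (fun i => ?_) f hf)
    refine hsoc.mem_of_lt (j := 6) (by norm_num) ?_
    exact isHomogeneous_iff_mem_polyPiece.1 (by simpa using (isHomogeneous_X K i).pow 6)
  · exact hd
  · exfalso
    have h2 := hilbertFunction_add_finrank_idealPiece I (2 : ℕ)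
    have h3 := hilbertFunction_add_finrank_idealPiece I (3 : ℕ)
    rw [idealPiece_eq_bot hG hGI (by omega), finrank_bot, finrank_polyPiece_four] at h2 h3
    have := hAG.hilbertFunction_symm hsoc (j := 2) (k := 3) (by norm_num)
    simp [Nat.choose] at h2 h3
    push_cast at this
    omega

/-- The Hilbert function is the one of `S` up to degree `2`, and the rest follows by symmetry. -/
lemma IsArtinGorenstein.hasHVector (hAG : IsArtinGorenstein I) (hsoc : HasSocleDegree I (5 : ℕ))
    {G : Set (PolyRing 4 K)} (hG : ∀ g ∈ G, g.IsHomogeneous 3) (hGI : Ideal.span G = I) :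
    HasHVector I ![1, 4, 10, 10, 4, 1] := by
  have hlow : ∀ j : ℕ, j < 3 → hilbertFunction I j = (j + 3).choose 3 := fun j hj => by
    have := hilbertFunction_add_finrank_idealPiece I j
    rwa [idealPiece_eq_bot hG hGI (by omega), finrank_bot, finrank_polyPiece_four] at this
  have h0 := hlow 0 (by norm_num)
  have h1 := hlow 1 (by norm_num)
  have h2 := hlow 2 (by norm_num)
  have h3 := hAG.hilbertFunction_symm hsoc (j := 3) (k := 2) (by norm_num)
  have h4 := hAG.hilbertFunction_symm hsoc (j := 4) (k := 1) (by norm_num)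
  have h5 := hAG.hilbertFunction_symm hsoc (j := 5) (k := 0) (by norm_num)
  constructor
  · intro i
    fin_cases i
    · exact h0
    · exact h1
    · exact h2
    · exact h3.trans h2
    · exact h4.trans h1
    · exact h5.trans h0
  · rintro j (hj | hj)
    · rw [hilbertFunction, quotPiece, polyPiece_neg hj, Submodule.map_bot, finrank_bot]
    · rw [hilbertFunction, quotPiece_eq_bot_iff.2 fun f hf => hsoc.mem_of_lt hj hf, finrank_bot]

end SocleDegreeFive

end

/-! ### Graded free modules and alternating sums of Betti numbers -/

section

variable {K : Type*} [Field K]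

section GradedFree

variable {n r r' : ℕ}

/-- The degree `j` piece of the graded free module `⨁_p S(-deg p)`. -/
def freePiece (K : Type*) [Field K] (n : ℕ) (deg : Fin r → ℤ) (j : ℤ) :
    Submodule K (Fin r → PolyRing n K) :=
  Submodule.pi Set.univ fun p => polyPiece n K (j - deg p)

lemma mem_freePiece {deg : Fin r → ℤ} {j : ℤ} {v : Fin r → PolyRing n K} :
    v ∈ freePiece K n deg j ↔ ∀ p, v p ∈ polyPiece n K (j - deg p) := by
  simp [freePiece, Submodule.mem_pi]

/-- The degree `j` component of an element of the graded free module `⨁_p S(-deg p)`. -/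
def freeComp (deg : Fin r → ℤ) (j : ℤ) (v : Fin r → PolyRing n K) : Fin r → PolyRing n K :=
  fun p => hcomp (j - deg p) (v p)

lemma freeComp_mem (deg : Fin r → ℤ) (j : ℤ) (v : Fin r → PolyRing n K) :
    freeComp deg j v ∈ freePiece K n deg j :=
  mem_freePiece.2 fun _ => hcomp_mem _ _

lemma freeComp_of_mem {deg : Fin r → ℤ} {j : ℤ} {v : Fin r → PolyRing n K}
    (hv : v ∈ freePiece K n deg j) : freeComp deg j v = v :=
  funext fun p => hcomp_of_mem (mem_freePiece.1 hv p)

lemma sum_smul_single (v : Fin r → PolyRing n K) :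
    ∑ q, v q • (Pi.single q 1 : Fin r → PolyRing n K) = v := by
  conv_rhs => rw [← Finset.univ_sum_single v]
  refine Finset.sum_congr rfl fun q _ => ?_
  rw [← Pi.single_smul, smul_eq_mul, mul_one]

lemma freeComp_map {deg : Fin r → ℤ} {deg' : Fin r' → ℤ}
    {T : (Fin r' → PolyRing n K) →ₗ[PolyRing n K] (Fin r → PolyRing n K)}
    (hT : ∀ q p, T (Pi.single q 1) p ∈ polyPiece n K (deg' q - deg p)) (j : ℤ)
    (v : Fin r' → PolyRing n K) : freeComp deg j (T v) = T (freeComp deg' j v) := by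
  have hsum : ∀ (w : Fin r' → PolyRing n K) p, T w p = ∑ q, w q * T (Pi.single q 1) p := by
    intro w p
    conv_lhs => rw [← sum_smul_single w]
    simp
  funext p
  rw [hsum, freeComp, hsum, map_sum]
  refine Finset.sum_congr rfl fun q _ => ?_
  rw [hcomp_mul_right _ _ (hT q p), freeComp]
  congr 3
  ring

lemma map_mem_freePiece {deg : Fin r → ℤ} {deg' : Fin r' → ℤ}
    {T : (Fin r' → PolyRing n K) →ₗ[PolyRing n K] (Fin r → PolyRing n K)}
    (hT : ∀ q p, T (Pi.single q 1) p ∈ polyPiece n K (deg' q - deg p)) {j : ℤ}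
    {v : Fin r' → PolyRing n K} (hv : v ∈ freePiece K n deg' j) : T v ∈ freePiece K n deg j := by
  rw [← freeComp_of_mem hv, ← freeComp_map hT]
  exact freeComp_mem _ _ _

/-- The graded piece of a free module is the product of shifted pieces of `S`. -/
def freePieceEquiv (K : Type*) [Field K] (n : ℕ) (deg : Fin r → ℤ) (j : ℤ) :
    freePiece K n deg j ≃ₗ[K] ((p : Fin r) → polyPiece n K (j - deg p)) where
  toFun v p := ⟨v.1 p, mem_freePiece.1 v.2 p⟩
  map_add' _ _ := rfl
  map_smul' _ _ := rfl
  invFun w := ⟨fun p => (w p).1, mem_freePiece.2 fun p => (w p).2⟩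
  left_inv _ := rfl
  right_inv _ := rfl

instance finite_freePiece (deg : Fin r → ℤ) (j : ℤ) : Module.Finite K (freePiece K n deg j) :=
  Module.Finite.equiv (freePieceEquiv K n deg j).symm

lemma finrank_freePiece (deg : Fin r → ℤ) (j : ℤ) :
    Module.finrank K (freePiece K n deg j) =
      ∑ p, Module.finrank K (polyPiece n K (j - deg p)) := by
  rw [(freePieceEquiv K n deg j).finrank_eq, Module.finrank_pi_fintype]

end GradedFree

/-- Rank-nullity for the restriction of a linear map to a subspace. -/
lemma finrank_map_add_finrank_of_ker {V W : Type*} [AddCommGroup V] [Module K V] [AddCommGroup W]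
    [Module K W] (f : V →ₗ[K] W) {P Q : Submodule K V} [Module.Finite K P] (hQ : Q ≤ P)
    (hker : ∀ v ∈ P, f v = 0 ↔ v ∈ Q) :
    Module.finrank K (P.map f) + Module.finrank K Q = Module.finrank K P := by
  have h1 := (f.domRestrict P).finrank_range_add_finrank_ker
  have h2 : LinearMap.ker (f.domRestrict P) = Q.comap P.subtype := by
    ext v
    exact hker v v.2
  rw [LinearMap.range_domRestrict, h2, (Submodule.comapSubtypeEquivOfLe hQ).finrank_eq] at h1
  exact h1

namespace MinimalGradedFreeResolution

section General

variable {n : ℕ} {I : Ideal (PolyRing n K)} (F : MinimalGradedFreeResolution I)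

/-- The degrees of the generators increase strictly along a minimal resolution. -/
lemma exists_deg_lt (i : ℕ) (q : Fin (F.rank (i + 1))) : ∃ p, F.deg i p < F.deg (i + 1) q := by
  have hne : F.d i (Pi.single q 1) ≠ 0 := by
    intro h0
    obtain ⟨w, hw⟩ := (F.exact_succ i _).1 h0
    have h1 := F.minimal (i + 1) w q
    rw [hw, mem_maxIdeal] at h1
    simp at h1
  obtain ⟨p, hp⟩ := Function.ne_iff.1 hne
  refine ⟨p, ?_⟩
  have := pos_of_mem_maxIdeal (F.d_homogeneous i q p) (F.minimal i _ p) hp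
  omega

/-- The dimension of the degree `j` piece of `F_i`. -/
def pieceDim (i : ℕ) (j : ℤ) : ℕ := Module.finrank K (freePiece K n (F.deg i) j)

/-- The dimension of the degree `j` piece of the image of `F_{i+1}` in `F_i`. -/
def imageDim (i : ℕ) (j : ℤ) : ℕ :=
  Module.finrank K ((freePiece K n (F.deg (i + 1)) j).map ((F.d i).restrictScalars K))

lemma map_freePiece_le (i : ℕ) (j : ℤ) :
    (freePiece K n (F.deg (i + 1)) j).map ((F.d i).restrictScalars K) ≤
      freePiece K n (F.deg i) j := by
  rintro _ ⟨v, hv, rfl⟩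
  exact map_mem_freePiece (F.d_homogeneous i) hv

lemma mem_map_freePiece {i : ℕ} {j : ℤ} {v : Fin (F.rank i) → PolyRing n K}
    (hv : v ∈ freePiece K n (F.deg i) j) (hr : v ∈ LinearMap.range (F.d i)) :
    v ∈ (freePiece K n (F.deg (i + 1)) j).map ((F.d i).restrictScalars K) := by
  obtain ⟨w, rfl⟩ := hr
  exact ⟨_, freeComp_mem _ j w,
    (freeComp_map (F.d_homogeneous i) j w).symm.trans (freeComp_of_mem hv)⟩

lemma pieceDim_succ (i : ℕ) (j : ℤ) :
    F.imageDim i j + F.imageDim (i + 1) j = F.pieceDim (i + 1) j :=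
  finrank_map_add_finrank_of_ker _ (F.map_freePiece_le (i + 1) j) fun v hv => by
    constructor
    · intro h
      exact F.mem_map_freePiece hv ((F.exact_succ i v).1 h)
    · rintro ⟨w, _, rfl⟩
      exact (F.exact_succ i _).2 ⟨w, rfl⟩

lemma pieceDim_zero (hI : ∀ f ∈ I, ∀ j : ℤ, hcomp j f ∈ I) (j : ℤ) :
    hilbertFunction I j + F.imageDim 0 j = F.pieceDim 0 j := by
  choose a ha ha' using F.aug_homogeneous
  have haug : ∀ v, F.aug v = Ideal.Quotient.mk I (∑ p, v p * a p) := fun v => by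
    conv_lhs => rw [← sum_smul_single v]
    simp only [map_sum, map_smul, ← ha', map_mul]
    rfl
  have hmap : (freePiece K n (F.deg 0) j).map (F.aug.restrictScalars K) = quotPiece I j := by
    apply le_antisymm
    · rintro _ ⟨v, hv, rfl⟩
      refine ⟨∑ p, v p * a p, Submodule.sum_mem _ fun p _ => ?_, (haug v).symm⟩
      have := mul_mem_polyPiece (mem_freePiece.1 hv p) (ha p)
      rwa [sub_add_cancel] at this
    · rintro _ ⟨f, hf, rfl⟩
      obtain ⟨v, hv⟩ := F.aug_surjective (Ideal.Quotient.mk I f)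
      refine ⟨freeComp (F.deg 0) j v, freeComp_mem _ _ _, ?_⟩
      rw [haug, Ideal.Quotient.eq] at hv
      have h1 := hI _ hv j
      rw [map_sub, map_sum, hcomp_of_mem hf] at h1
      refine (haug _).trans ((Ideal.Quotient.eq).2 ?_)
      convert h1 using 3 with p
      exact (hcomp_mul_right j (v p) (ha p)).symm
  rw [hilbertFunction, ← hmap]
  refine finrank_map_add_finrank_of_ker _ (F.map_freePiece_le 0 j) fun v hv => ?_
  constructor
  · intro h
    exact F.mem_map_freePiece hv ((F.exact_zero v).1 h)
  · rintro ⟨w, _, rfl⟩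
    exact (F.exact_zero _).2 ⟨w, rfl⟩

lemma imageDim_eq_zero {i : ℕ} (h : F.rank (i + 1) = 0) (j : ℤ) : F.imageDim i j = 0 := by
  have : IsEmpty (Fin (F.rank (i + 1))) := by rw [h]; infer_instance
  have hb : freePiece K n (F.deg (i + 1)) j = ⊥ := (Submodule.eq_bot_iff _).2 fun v _ =>
    Subsingleton.elim _ _
  rw [imageDim, hb, Submodule.map_bot, finrank_bot]

lemma betti_eq_sum (i : ℕ) (j : ℤ) : F.betti i j = ∑ p, if F.deg i p = j then 1 else 0 := by
  rw [betti, Fintype.card_subtype, Finset.card_filter]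

lemma betti_of_forall {i : ℕ} {k : ℤ} (h : ∀ p, F.deg i p = k) (j : ℤ) :
    F.betti i j = if j = k then F.rank i else 0 := by
  rw [betti_eq_sum]
  simp only [h]
  split_ifs with h1 h2 h2
  · simp
  · exact absurd h1.symm h2
  · exact absurd h2.symm h1
  · simp

lemma betti_pos (i : ℕ) (p : Fin (F.rank i)) : 0 < F.betti i (F.deg i p) :=
  Fintype.card_pos_iff.2 ⟨⟨p, rfl⟩⟩

lemma deg_eq_or_of_betti_add {i : ℕ} {j k : ℤ} (hjk : j ≠ k)
    (h : F.rank i ≤ F.betti i j + F.betti i k) (p : Fin (F.rank i)) :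
    F.deg i p = j ∨ F.deg i p = k := by
  classical
  by_contra! hp
  rw [betti_eq_sum, betti_eq_sum, ← Finset.sum_add_distrib] at h
  have : ∑ p, ((if F.deg i p = j then 1 else 0) + if F.deg i p = k then 1 else 0) <
      ∑ _p : Fin (F.rank i), 1 := by
    refine Finset.sum_lt_sum (fun q _ => ?_) ⟨p, Finset.mem_univ _, ?_⟩
    · split_ifs with h1 h2 <;> simp_all
    · simp [hp.1, hp.2]
  simp at this
  omega

lemma betti_add_betti_le (i : ℕ) {j k : ℤ} (hjk : j ≠ k) :
    F.betti i j + F.betti i k ≤ F.rank i := by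
  classical
  rw [betti_eq_sum, betti_eq_sum, ← Finset.sum_add_distrib]
  have : ∑ p, ((if F.deg i p = j then 1 else 0) + if F.deg i p = k then 1 else 0) ≤
      ∑ _p : Fin (F.rank i), 1 := by
    refine Finset.sum_le_sum (fun q _ => ?_)
    split_ifs with h1 h2 <;> simp_all
  simpa using this

end General

end MinimalGradedFreeResolution

/-- The fourth difference of a function on `ℤ`; it corresponds to the multiplication of a Hilbert
series by `(1 - t)^4`. -/
def diff4 (h : ℤ → ℤ) (j : ℤ) : ℤ := h j - 4 * h (j - 1) + 6 * h (j - 2) - 4 * h (j - 3) + h (j - 4)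

lemma diff4_finrank_polyPiece (j : ℤ) :
    diff4 (fun m => (Module.finrank K (polyPiece 4 K m) : ℤ)) j = if j = 0 then 1 else 0 := by
  have hneg : ∀ m < 0, (Module.finrank K (polyPiece 4 K m) : ℤ) = 0 := fun m hm => by
    rw [polyPiece_neg hm, finrank_bot]; rfl
  -- the polynomial formula for `dim S_m` remains valid for `m = -1, -2, -3`
  have hpoly : ∀ m, -3 ≤ m →
      6 * (Module.finrank K (polyPiece 4 K m) : ℤ) = (m + 1) * (m + 2) * (m + 3) := by
    intro m hm
    rcases lt_or_ge m 0 with h | h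
    · rw [hneg m h]
      interval_cases m <;> norm_num
    · obtain ⟨k, rfl⟩ := Int.eq_ofNat_of_zero_le h
      rw [finrank_polyPiece_four]
      have := Nat.descFactorial_eq_factorial_mul_choose (k + 3) 3
      simp [Nat.descFactorial, Nat.factorial] at this
      have h2 : (6 : ℤ) * ((k + 3).choose 3 : ℕ) = ((k + 1) * ((k + 2) * (k + 3)) : ℕ) := by
        rw [this]; push_cast; ring
      rw [h2]; push_cast; ring
  unfold diff4
  rcases lt_trichotomy j 0 with h | h | h
  · rw [if_neg h.ne]
    simp only [hneg _ (show j < 0 by omega), hneg _ (show j - 1 < 0 by omega),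
      hneg _ (show j - 2 < 0 by omega), hneg _ (show j - 3 < 0 by omega),
      hneg _ (show j - 4 < 0 by omega)]
    norm_num
  · subst h
    have := hpoly 0 (by norm_num)
    simp only [hneg (0 - 1) (by norm_num), hneg (0 - 2) (by norm_num),
      hneg (0 - 3) (by norm_num), hneg (0 - 4) (by norm_num)]
    simp
    omega
  · rw [if_neg h.ne']
    have h0 := hpoly j (by omega)
    have h1 := hpoly (j - 1) (by omega)
    have h2 := hpoly (j - 2) (by omega)
    have h3 := hpoly (j - 3) (by omega)
    have h4 := hpoly (j - 4) (by omega)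
    refine (mul_eq_zero_iff_left (show (6 : ℤ) ≠ 0 by norm_num)).1 ?_
    linear_combination h0 - 4 * h1 + 6 * h2 - 4 * h3 + h4

namespace MinimalGradedFreeResolution

variable {I : Ideal (PolyRing 4 K)} (F : MinimalGradedFreeResolution I)

lemma diff4_pieceDim (i : ℕ) (j : ℤ) :
    diff4 (fun m => (F.pieceDim i m : ℤ)) j = F.betti i j := by
  obtain ⟨σ, hσ⟩ : ∃ σ : ℤ → ℤ, σ = fun m => (Module.finrank K (polyPiece 4 K m) : ℤ) := ⟨_, rfl⟩
  have h1 : ∀ m, (F.pieceDim i m : ℤ) = ∑ p, σ (m - F.deg i p) := fun m => by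
    rw [pieceDim, finrank_freePiece, Nat.cast_sum, hσ]
  have h2 : diff4 (fun m => (F.pieceDim i m : ℤ)) j = ∑ p, diff4 σ (j - F.deg i p) := by
    simp only [diff4, h1, Finset.sum_add_distrib, Finset.sum_sub_distrib, Finset.mul_sum,
      sub_right_comm j (F.deg i _)]
  rw [h2, betti_eq_sum, Nat.cast_sum]
  refine Finset.sum_congr rfl fun p _ => ?_
  rw [hσ, diff4_finrank_polyPiece]
  have : j - F.deg i p = 0 ↔ F.deg i p = j := by omega
  simp [this]

/-- The alternating sum of the Betti numbers in a fixed degree is a coefficient of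
`(1 - t)^4` times the Hilbert series. -/
lemma alternating_sum_betti (hI : ∀ f ∈ I, ∀ j : ℤ, hcomp j f ∈ I) (j : ℤ) :
    (F.betti 0 j : ℤ) - F.betti 1 j + F.betti 2 j - F.betti 3 j + F.betti 4 j =
      diff4 (fun m => (hilbertFunction I m : ℤ)) j := by
  have key : ∀ m, (hilbertFunction I m : ℤ) = F.pieceDim 0 m - F.pieceDim 1 m + F.pieceDim 2 m -
      F.pieceDim 3 m + F.pieceDim 4 m := fun m => by
    have h0 := F.pieceDim_zero hI m
    have h1 := F.pieceDim_succ 0 m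
    have h2 := F.pieceDim_succ 1 m
    have h3 := F.pieceDim_succ 2 m
    have h4 := F.pieceDim_succ 3 m
    have h5 := F.imageDim_eq_zero (F.rank_add_five 0) m
    simp only [zero_add, Nat.reduceAdd] at h1 h2 h3 h4 h5
    omega
  simp only [← diff4_pieceDim, diff4, key]
  ring

end MinimalGradedFreeResolution

end

/-! ### The Betti numbers -/

section

variable {K : Type*} [Field K] {I : Ideal (PolyRing 4 K)}

/-- The coefficients of `(1 - t)^4 (1 + 4t + 10t² + 10t³ + 4t⁴ + t⁵)`. -/
lemma HasHVector.diff4_hilbertFunction (hH : HasHVector I ![1, 4, 10, 10, 4, 1]) (j : ℤ) :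
    diff4 (fun m => (hilbertFunction I m : ℤ)) j =
      if j = 0 then 1 else if j = 3 then -10 else if j = 4 then 9 else if j = 5 then 9 else
        if j = 6 then -10 else if j = 9 then 1 else 0 := by
  obtain ⟨hin, hout⟩ := hH
  have h0 : hilbertFunction I 0 = 1 := hin 0
  have h1 : hilbertFunction I 1 = 4 := hin 1
  have h2 : hilbertFunction I 2 = 10 := hin 2
  have h3 : hilbertFunction I 3 = 10 := hin 3
  have h4 : hilbertFunction I 4 = 4 := hin 4
  have h5 : hilbertFunction I 5 = 1 := hin 5
  have hval : ∀ m : ℤ, (hilbertFunction I m : ℤ) = if m = 0 then 1 else if m = 1 then 4 else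
      if m = 2 then 10 else if m = 3 then 10 else if m = 4 then 4 else if m = 5 then 1 else 0 := by
    intro m
    by_cases hm : 0 ≤ m ∧ m ≤ 5
    · obtain ⟨hm0, hm5⟩ := hm
      interval_cases m <;> simp [h0, h1, h2, h3, h4, h5]
    · rw [hout m (by omega)]
      rw [if_neg, if_neg, if_neg, if_neg, if_neg, if_neg] <;> first | rfl | omega
  by_cases hj : 0 ≤ j ∧ j ≤ 9
  · simp only [diff4, hval]
    obtain ⟨hj0, hj9⟩ := hj
    interval_cases j <;> rfl
  · rw [if_neg (by omega), if_neg (by omega), if_neg (by omega), if_neg (by omega),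
      if_neg (by omega), if_neg (by omega)]
    simp only [diff4]
    rw [hout j (by omega), hout (j - 1) (by omega), hout (j - 2) (by omega),
      hout (j - 3) (by omega), hout (j - 4) (by omega)]
    norm_num

namespace MinimalGradedFreeResolution

/-- The Betti numbers are determined by the total ranks `1, 10, ?, 10, 1`, by the alternating sums
of the Betti numbers in every degree, and by the growth of the degrees of the generators. -/
lemma betti_eq (F : MinimalGradedFreeResolution I) (hI : ∀ f ∈ I, ∀ j : ℤ, hcomp j f ∈ I)
    (hH : HasHVector I ![1, 4, 10, 10, 4, 1]) (r0 : F.rank 0 = 1) (r1 : F.rank 1 = 10)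
    (r3 : F.rank 3 = 10) (r4 : F.rank 4 = 1) (j : ℤ) :
    F.betti 0 j = (if j = 0 then 1 else 0) ∧ F.betti 1 j = (if j = 3 then 10 else 0) ∧
    F.betti 2 j = (if j = 4 then 9 else if j = 5 then 9 else 0) ∧
    F.betti 3 j = (if j = 6 then 10 else 0) ∧ F.betti 4 j = (if j = 9 then 1 else 0) := by
  have hc : ∀ m, _ := fun m => (F.alternating_sum_betti hI m).trans (hH.diff4_hilbertFunction m)
  have c3 := hc 3
  have c6 := hc 6
  norm_num at c3 c6
  have s1 := F.betti_add_betti_le 1 (show (3 : ℤ) ≠ 6 by norm_num)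
  have s3 := F.betti_add_betti_le 3 (show (3 : ℤ) ≠ 6 by norm_num)
  -- the coefficients in degrees `3` and `6` use up all generators of `F₁` and `F₃`
  have d1 := F.deg_eq_or_of_betti_add (i := 1) (show (3 : ℤ) ≠ 6 by norm_num) (by omega)
  have d3 := F.deg_eq_or_of_betti_add (i := 3) (show (3 : ℤ) ≠ 6 by norm_num) (by omega)
  have d2 : ∀ p, 4 ≤ F.deg 2 p := fun p => by
    obtain ⟨q, hq⟩ := F.exists_deg_lt 1 p
    rcases d1 q with h | h <;> simp at hq <;> omega
  have d3' : ∀ p, F.deg 3 p = 6 := fun p => by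
    obtain ⟨q, hq⟩ := F.exists_deg_lt 2 p
    have := d2 q
    rcases d3 p with h | h <;> simp at hq <;> omega
  have d4 : ∀ p, 7 ≤ F.deg 4 p := fun p => by
    obtain ⟨q, hq⟩ := F.exists_deg_lt 3 p
    have := d3' q
    simp at hq
    omega
  have b3 := F.betti_of_forall d3'
  have b33 := b3 3
  norm_num at b33
  have d1' : ∀ p, F.deg 1 p = 3 := fun p => by
    rcases d1 p with h | h
    · exact h
    · have := F.betti_pos 1 p
      rw [h] at this
      omega
  have b1 := F.betti_of_forall d1'
  have hpos : ∀ m, (F.betti 0 m : ℤ) + F.betti 2 m + F.betti 4 m =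
      if m = 0 then 1 else if m = 4 then 9 else if m = 5 then 9 else if m = 9 then 1 else 0 := by
    intro m
    have h := hc m
    rw [b1, b3, r1, r3] at h
    split_ifs at h ⊢ <;> push_cast at h <;> omega
  have d0 : ∀ p, F.deg 0 p = 0 := fun p => by
    obtain ⟨p', hp'⟩ := F.exists_deg_lt 0 (Fin.cast r1.symm 0)
    have hpp : p' = p := (Fin.subsingleton_iff_le_one.2 r0.le).elim _ _
    have h1 : F.deg 0 p < 3 := by rwa [hpp, d1'] at hp'
    have h2 := F.betti_pos 0 p
    have h3 := hpos (F.deg 0 p)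
    split_ifs at h3 <;> omega
  have b0 := F.betti_of_forall d0
  have d4' : ∀ p, F.deg 4 p = 9 := fun p => by
    have h1 := d4 p
    have h2 := F.betti_pos 4 p
    have h3 := hpos (F.deg 4 p)
    split_ifs at h3 <;> omega
  have b4 := F.betti_of_forall d4'
  have h2 := hpos j
  rw [b0, b4, r0, r4] at h2
  rw [b0, b1, b3, b4, r0, r1, r3, r4]
  refine ⟨rfl, rfl, ?_, rfl, rfl⟩
  split_ifs at h2 ⊢ <;> push_cast at h2 <;> omega

end MinimalGradedFreeResolution

end

/-! ### Existence of minimal graded free resolutions -/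

section

variable {K : Type*} [Field K] {n : ℕ}

/-- A graded submodule `N` of a graded free module `⨁_p S(-deg p)` that is contained in
`(x_1, …, x_n)` times that module: the kernel at one stage of a minimal resolution. -/
structure MinimalSyzygy (n : ℕ) (K : Type*) [Field K] where
  /-- the rank of the free module -/
  rank : ℕ
  /-- the degrees of its basis vectors -/
  deg : Fin rank → ℤ
  /-- the submodule -/
  N : Submodule (PolyRing n K) (Fin rank → PolyRing n K)
  graded : ∀ v ∈ N, ∀ j, freeComp deg j v ∈ N
  le_maxIdeal : ∀ v ∈ N, ∀ p, v p ∈ maxIdeal n K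

/-- An element of a graded free module is the sum of its components. -/
lemma exists_sum_freeComp {r : ℕ} (deg : Fin r → ℤ) (v : Fin r → PolyRing n K) :
    ∃ J : Finset ℤ, ∑ j ∈ J, freeComp deg j v = v := by
  classical
  refine ⟨Finset.univ.biUnion fun p => (v p).support.image fun d => (d.degree : ℤ) + deg p, ?_⟩
  funext p
  ext d
  rw [Finset.sum_apply, coeff_sum]
  simp only [freeComp, coeff_hcomp]
  by_cases hd : coeff d (v p) = 0
  · simp [hd]
  · rw [Finset.sum_eq_single ((d.degree : ℤ) + deg p)]
    · rw [if_pos (by ring)]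
    · intro j _ hj
      rw [if_neg]
      omega
    · intro hj
      refine absurd (Finset.mem_biUnion.2 ⟨p, Finset.mem_univ _, ?_⟩) hj
      exact Finset.mem_image_of_mem _ (mem_support_iff.2 hd)

/-- A system of `k` homogeneous generators of the graded submodule. -/
def MinimalSyzygy.HasGenerators (Y : MinimalSyzygy n K) (k : ℕ) : Prop :=
  ∃ (g : Fin k → Fin Y.rank → PolyRing n K) (e : Fin k → ℤ),
    (∀ q, g q ∈ freePiece K n Y.deg (e q)) ∧ Submodule.span (PolyRing n K) (Set.range g) = Y.N

lemma MinimalSyzygy.exists_hasGenerators (Y : MinimalSyzygy n K) : ∃ k, Y.HasGenerators k := by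
  have hspan : Submodule.span (PolyRing n K) {v | v ∈ Y.N ∧ ∃ j, v ∈ freePiece K n Y.deg j} =
      Y.N := by
    refine le_antisymm (Submodule.span_le.2 fun v hv => hv.1) fun v hv => ?_
    obtain ⟨J, hJ⟩ := exists_sum_freeComp Y.deg v
    rw [← hJ]
    exact Submodule.sum_mem _ fun j _ =>
      Submodule.subset_span ⟨Y.graded v hv j, j, freeComp_mem _ _ _⟩
  have hfg : Y.N.FG := IsNoetherian.noetherian _
  rw [← hspan, Submodule.fg_span_iff_fg_span_finset_subset] at hfg
  obtain ⟨s, hs, hs'⟩ := hfg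
  have hj : ∀ q : Fin s.card, ∃ j, ((s.equivFin.symm q : s) : Fin Y.rank → PolyRing n K) ∈
      freePiece K n Y.deg j := fun q => (hs (s.equivFin.symm q).2).2
  choose e he using hj
  refine ⟨s.card, fun q => s.equivFin.symm q, e, he, ?_⟩
  rw [← hspan, hs']
  congr 1
  ext v
  constructor
  · rintro ⟨q, rfl⟩
    exact (s.equivFin.symm q).2
  · intro hv
    exact ⟨s.equivFin ⟨v, hv⟩, by simp⟩

/-- Existence of a minimal homogeneous cover: take a system of homogeneous generators of smallest
cardinality. A relation with a coefficient outside the maximal ideal would allow dropping one of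
them. -/
lemma MinimalSyzygy.exists_cover (Y : MinimalSyzygy n K) :
    ∃ (k : ℕ) (e : Fin k → ℤ)
      (T : (Fin k → PolyRing n K) →ₗ[PolyRing n K] (Fin Y.rank → PolyRing n K)),
      (∀ q p, T (Pi.single q 1) p ∈ polyPiece n K (e q - Y.deg p)) ∧
      LinearMap.range T = Y.N ∧ ∀ v, T v = 0 → ∀ p, v p ∈ maxIdeal n K := by
  classical
  obtain ⟨k, ⟨g, e, hge, hspan⟩, hmin⟩ : ∃ k, Y.HasGenerators k ∧ ∀ k' < k, ¬ Y.HasGenerators k' :=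
    ⟨_, Nat.find_spec Y.exists_hasGenerators, fun _ h => Nat.find_min Y.exists_hasGenerators h⟩
  let T : (Fin k → PolyRing n K) →ₗ[PolyRing n K] (Fin Y.rank → PolyRing n K) :=
    Fintype.linearCombination (PolyRing n K) g
  have hT : ∀ v, T v = ∑ q, v q • g q := fun v => Fintype.linearCombination_apply _ _ _
  have hTg : ∀ q, T (Pi.single q 1) = g q := fun q => by
    rw [hT, Finset.sum_eq_single q (fun i _ hi => by rw [Pi.single_eq_of_ne hi, zero_smul])
      (fun h => absurd (Finset.mem_univ q) h), Pi.single_eq_same, one_smul]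
  have hTh : ∀ q p, T (Pi.single q 1) p ∈ polyPiece n K (e q - Y.deg p) := fun q p => by
    rw [hTg]
    exact mem_freePiece.1 (hge q) p
  refine ⟨k, e, T, hTh, (Fintype.range_linearCombination _ _).trans hspan, fun v hv p => ?_⟩
  rw [mem_maxIdeal]
  by_contra hc
  -- the component of degree `e p` of the relation `v` has a nonzero constant coefficient at `p`
  have h1 : ∑ q, freeComp e (e p) v q • g q = 0 := by
    rw [← hT, ← freeComp_map hTh, hv]
    funext r
    exact map_zero _
  have h2 : freeComp e (e p) v p = C (constantCoeff (v p)) := by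
    rw [freeComp, sub_self, mem_polyPiece_zero (hcomp_mem 0 (v p)), constantCoeff_hcomp_zero]
  obtain _ | k := k
  · exact p.elim0
  refine hmin k (Nat.lt_succ_self k) ⟨g ∘ p.succAbove, e ∘ p.succAbove, fun q => hge _, ?_⟩
  rw [← hspan]
  refine le_antisymm (Submodule.span_mono (Set.range_comp_subset_range _ _)) ?_
  rw [Submodule.span_le]
  have hq : ∀ q, g (p.succAbove q) ∈
      Submodule.span (PolyRing n K) (Set.range (g ∘ p.succAbove)) := fun q =>
    Submodule.subset_span ⟨q, rfl⟩
  rintro _ ⟨q, rfl⟩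
  rcases Fin.eq_self_or_eq_succAbove p q with rfl | ⟨q', rfl⟩
  · rw [Fin.sum_univ_succAbove _ q, h2] at h1
    have h3 : g q = (C (-(constantCoeff (v q))⁻¹) : PolyRing n K) •
        ∑ i, freeComp e (e q) v (q.succAbove i) • g (q.succAbove i) := by
      rw [← neg_eq_iff_add_eq_zero] at h1
      rw [← h1, smul_neg, smul_smul, ← C_mul, neg_mul, inv_mul_cancel₀ hc]
      simp
    rw [h3]
    exact Submodule.smul_mem _ _ (Submodule.sum_mem _ fun i _ => Submodule.smul_mem _ _ (hq i))
  · exact hq q'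

/-- The next syzygy module in a minimal resolution: the kernel of a minimal cover. -/
def MinimalSyzygy.next (Y : MinimalSyzygy n K) : MinimalSyzygy n K where
  rank := Y.exists_cover.choose
  deg := Y.exists_cover.choose_spec.choose
  N := LinearMap.ker Y.exists_cover.choose_spec.choose_spec.choose
  graded v hv j := by
    have h := Y.exists_cover.choose_spec.choose_spec.choose_spec.1
    rw [LinearMap.mem_ker] at hv ⊢
    rw [← freeComp_map h, hv]
    funext p
    exact map_zero _
  le_maxIdeal := Y.exists_cover.choose_spec.choose_spec.choose_spec.2.2

/-- The minimal cover of a syzygy module, as a map between free modules. -/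
def MinimalSyzygy.cover (Y : MinimalSyzygy n K) :
    (Fin Y.next.rank → PolyRing n K) →ₗ[PolyRing n K] (Fin Y.rank → PolyRing n K) :=
  Y.exists_cover.choose_spec.choose_spec.choose

lemma MinimalSyzygy.cover_homogeneous (Y : MinimalSyzygy n K) (q : Fin Y.next.rank)
    (p : Fin Y.rank) : Y.cover (Pi.single q 1) p ∈ polyPiece n K (Y.next.deg q - Y.deg p) :=
  Y.exists_cover.choose_spec.choose_spec.choose_spec.1 q p

lemma MinimalSyzygy.range_cover (Y : MinimalSyzygy n K) : LinearMap.range Y.cover = Y.N :=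
  Y.exists_cover.choose_spec.choose_spec.choose_spec.2.1

/-- A homogeneous proper ideal, as a syzygy module in `S`. -/
def MinimalSyzygy.ofIdeal (I : Ideal (PolyRing n K)) (hI : ∀ f ∈ I, ∀ j : ℤ, hcomp j f ∈ I)
    (hm : I ≤ maxIdeal n K) : MinimalSyzygy n K where
  rank := 1
  deg _ := 0
  N := LinearMap.ker (quotPresentation I)
  graded v hv j := by
    rw [LinearMap.mem_ker, quotPresentation_eq_zero] at hv ⊢
    exact hI _ hv _
  le_maxIdeal v hv p := by
    rw [LinearMap.mem_ker, quotPresentation_eq_zero] at hv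
    rw [Subsingleton.elim p 0]
    exact hm hv

lemma quotPresentation_single_mem (I : Ideal (PolyRing n K)) (p : Fin 1) :
    quotPresentation I (Pi.single p 1) ∈ quotPiece I 0 := by
  rw [quotPresentation_apply, Subsingleton.elim p 0, Pi.single_eq_same]
  exact mk_mem_quotPiece (isWeightedHomogeneous_one K _)

/-- Homogeneous proper ideals have minimal graded free resolutions. -/
lemma nonempty_minimalGradedFreeResolution {I : Ideal (PolyRing n K)}
    (hI : ∀ f ∈ I, ∀ j : ℤ, hcomp j f ∈ I) (hm : I ≤ maxIdeal n K) :
    Nonempty (MinimalGradedFreeResolution I) := by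
  let Y : ℕ → MinimalSyzygy n K := fun i =>
    Nat.rec (MinimalSyzygy.ofIdeal I hI hm) (fun _ Z => Z.next) i
  exact ⟨{
    rank := fun i => (Y i).rank
    deg := fun i => (Y i).deg
    d := fun i => (Y i).cover
    aug := quotPresentation I
    d_homogeneous := fun i q p => (Y i).cover_homogeneous q p
    aug_homogeneous := quotPresentation_single_mem I
    aug_surjective := quotPresentation_surjective I
    exact_zero := LinearMap.exact_iff.2 (Y 0).range_cover.symm
    exact_succ := fun i => LinearMap.exact_iff.2 (Y (i + 1)).range_cover.symm
    minimal := fun i v p => (Y i).le_maxIdeal _ ((Y i).range_cover ▸ ⟨v, rfl⟩) p }⟩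

end

end

end ArtinGor

theorem proposition4p1 {K : Type*} [Field K] [CharZero K]
    (I : Ideal (ArtinGor.PolyRing 4 K))
    (hAG : ArtinGor.IsArtinGorenstein I)
    (hsoc : ArtinGor.HasSocleDegree I 5)
    (heq : ArtinGor.IsEquigenerated I) :
    ArtinGor.HasHVector I ![1, 4, 10, 10, 4, 1] ∧
    ArtinGor.HasBettiTable I
      !![1,  0,  0,  0, 0;
         0,  0,  0,  0, 0;
         0, 10,  9,  0, 0;
         0,  0,  9, 10, 0;
         0,  0,  0,  0, 0;
         0,  0,  0,  0, 1] := by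
  obtain ⟨d, G, hG, hGI⟩ := heq
  have hs : ArtinGor.HasSocleDegree I (5 : ℕ) := hsoc
  obtain rfl := hAG.degree_eq_three hs hG hGI
  have hH := hAG.hasHVector hs hG hGI
  have hm := hAG.le_maxIdeal hs
  have hI : ∀ f ∈ I, ∀ j : ℤ, ArtinGor.hcomp j f ∈ I := fun f hf j => hAG.hcomp_mem hf j
  refine ⟨hH, ArtinGor.nonempty_minimalGradedFreeResolution hI hm, fun F => ?_⟩
  have r0 : F.rank 0 = 1 := F.rank_zero.trans (ArtinGor.finrank_koszulH0_quotient hm)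
  have r1 : F.rank 1 = 10 := by
    rw [F.rank_one, ArtinGor.finrank_koszulH1_quotient hm,
      ArtinGor.finrank_koszulH0_ideal hG hGI]
    have h1 := ArtinGor.hilbertFunction_add_finrank_idealPiece I (3 : ℕ)
    have h2 : ArtinGor.hilbertFunction I (3 : ℕ) = 10 := hH.1 3
    have h3 : Nat.choose (3 + 3) 3 = 20 := rfl
    rw [ArtinGor.finrank_polyPiece_four, h2, h3] at h1
    omega
  have r3 : F.rank 3 = 10 := by
    rw [F.rank_three, hAG.finrank_koszulH3 hs, ← F.rank_one, r1]
  have r4 : F.rank 4 = 1 := F.rank_four.trans hAG.socle_dim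
  have hb := F.betti_eq hI hH r0 r1 r3 r4
  constructor
  · intro j i
    obtain ⟨b0, b1, b2, b3, b4⟩ := hb (((i : ℕ) : ℤ) + ((j : ℕ) : ℤ))
    fin_cases i
    · refine b0.trans ?_
      fin_cases j <;> rfl
    · refine b1.trans ?_
      fin_cases j <;> rfl
    · refine b2.trans ?_
      fin_cases j <;> rfl
    · refine b3.trans ?_
      fin_cases j <;> rfl
    · refine b4.trans ?_
      fin_cases j <;> rfl
  · intro i j hij
    obtain ⟨b0, b1, b2, b3, b4⟩ := hb ((i : ℤ) + j)
    rcases lt_or_ge i 5 with hi | hi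
    · interval_cases i
      · rw [b0, if_neg (by omega)]
      · rw [b1, if_neg (by omega)]
      · rw [b2, if_neg (by omega), if_neg (by omega)]
      · rw [b3, if_neg (by omega)]
      · rw [b4, if_neg (by omega)]
    · obtain ⟨k, rfl⟩ := Nat.exists_eq_add_of_le' hi
      have : IsEmpty (Fin (F.rank (k + 5))) := by rw [F.rank_add_five k]; infer_instance
      exact Fintype.card_eq_zero
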